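/- Let $p$ be an odd prime and let $G$ be a finite $p$-group of exponent $\exp(G)=p^n$. Write $G^p$ for the subgroup of $G$ generated by all $p$-th powers of elements of $G$, and $\gamma_i(G)$ for the terms of the lower central series of $G$ ($\gamma_1(G)=G$, $\gamma_{i+1}(G)=[\gamma_i(G),G]$). Suppose that 1. $N=G^p$ is powerful, i.e. $[N,N]\le N^p$; 2. $\exp(G^p)=p^{n-1}$ (for the trivial group, $n=0$, this condition is regarded as satisfied); 3. $\gamma_{p+1}(G)\subseteq G^p$. Let $G\wedge G$ be the nonabelian exterior square of $G$, i.e. the group generated by symbols $g\wedge h$ ($g,h\in G$) subject to the relations $gg'\wedge h=({}^{g}g'\wedge{}^{g}h)(g\wedge h)$, $g\wedge hh'=(g\wedge h)({}^{h}g\wedge{}^{h}h')$ and $g\wedge g=1$ for all $g,g',h,h'\in G$, where ${}^{x}y=xyx^{-1}$; and let $M(G)=H_2(G,\mathbb Z)$ be the Schur multiplier of $G$. Then $\exp(G\wedge G)$ divides $\exp(G)$; in particular, $\exp(M(G))$ divides $\exp(G)$. -/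

import Mathlib

universe u

/-- The subgroup `G ^ m`, generated by the `m`-th powers of all elements of `G`. -/
def powerSubgroup (G : Type u) [Group G] (m : ℕ) : Subgroup G :=
  Subgroup.closure (Set.range fun g : G => g ^ m)

/-- A `p`-group `G` is powerful if `[G, G] ≤ G ^ p` for `p` odd, `[G, G] ≤ G ^ 4` for `p = 2`. -/
def IsPowerful (p : ℕ) (G : Type u) [Group G] : Prop :=
  commutator G ≤ powerSubgroup G (if p = 2 then 4 else p)

/-- The defining relators of the nonabelian exterior square, where the generator `g ∧ h` is the
free generator at `(g, h)` and `ˣy = x * y * x⁻¹`. -/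
inductive ExteriorSquareRel (G : Type u) [Group G] : FreeGroup (G × G) → Prop
  /-- `(g g') ∧ h = (ᵍg' ∧ ᵍh) (g ∧ h)` -/
  | mul_left (g g' h : G) : ExteriorSquareRel G
      (FreeGroup.of (g * g', h) *
        (FreeGroup.of (g * g' * g⁻¹, g * h * g⁻¹) * FreeGroup.of (g, h))⁻¹)
  /-- `g ∧ (h h') = (g ∧ h) (ʰg ∧ ʰh')` -/
  | mul_right (g h h' : G) : ExteriorSquareRel G
      (FreeGroup.of (g, h * h') *
        (FreeGroup.of (g, h) * FreeGroup.of (h * g * h⁻¹, h * h' * h⁻¹))⁻¹)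
  /-- `g ∧ g = 1` -/
  | diag (g : G) : ExteriorSquareRel G (FreeGroup.of (g, g))

/-- The nonabelian exterior square `G ∧ G`. -/
abbrev ExteriorSquare (G : Type u) [Group G] : Type u :=
  PresentedGroup {r : FreeGroup (G × G) | ExteriorSquareRel G r}

/-- The Schur multiplier `M(G) = H₂(G, ℤ)`, with trivial action on `ℤ` (lifted to the universe
of `G`). -/
noncomputable abbrev SchurMultiplier (G : Type u) [Group G] : Type u :=
  groupHomology (Rep.trivial (ULift.{u} ℤ) G (ULift.{u} ℤ)) 2

/-! Both conclusions reduce to one statement: if `q : K →* G` has central kernel, then `[K, K]` has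
exponent dividing `p ^ n` (`pow_eq_one_of_mem_commutator_of_central`). The exterior square embeds in
the commutator subgroup of such a `K`, and the multiplier consists of elements of a central kernel
that lie in `[K, K]`.

For the statement itself, let `W i` be the preimage in `K` of the `i`-th iterated power subgroup of
`N = G ^ p`, and let `Z = [W 0, K]`. In `K / Z` the image of `W 0` is central and contains all
`p`-th powers and `γ_{p+1}`, so `K / Z` is central-by-(exponent `p`, class at most `p`). For such a
group `L`, `[L, L]` has exponent dividing `p` (`pow_prime_eq_one_of_mem_commutator`), so `p`-th
powers of elements of `[K, K]` fall into `Z`. Since `N` is powerful of exponent `p ^ (n - 1)`, its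
power series vanishes after `n - 1` steps, so `W (n - 1)` is central. As `p` is odd, taking `p`-th
powers is multiplicative along the chain up to controlled commutators, and `Z` has exponent dividing
`p ^ (n - 1)` (`IsPowerChain.pow_eq_one`).

The theorem about `L` replaces commutator collection by polynomial sequences: sequences whose `i`-th
differences lie in the `i`-th step of a filtration form a group (Lazard, Leibman). If such a
sequence is trivial at 0 and 1, and `p`-th powers vanish deep enough, then its value at `p` is its
`p`-th difference to leading order (`polySeq_apply_prime`). Applied to conjugates `xⁿ y x⁻ⁿ` with `x
^ p` central, this expresses `[y⁻¹, x] ^ p` through an Engel commutator with `p` entries `x`. That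
commutator is trivial, because in exponent `p` already `p - 1` entries suffice modulo `γ_{p+1}`. -/

open scoped commutatorElement

/-! ### Commutator filtrations -/

/-- A descending series of subgroups `Γ 0 = G ≥ Γ 1 ≥ ⋯` with `[Γ i, Γ j] ≤ Γ (i + j)`. -/
structure IsCommFiltration {G : Type u} [Group G] (Γ : ℕ → Subgroup G) : Prop where
  zero : Γ 0 = ⊤
  antitone : Antitone Γ
  commutator_le : ∀ i j, ⁅Γ i, Γ j⁆ ≤ Γ (i + j)

namespace IsCommFiltration

variable {G : Type u} [Group G] {Γ : ℕ → Subgroup G}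

lemma commutator_mem (hΓ : IsCommFiltration Γ) {i j : ℕ} {x y : G} (hx : x ∈ Γ i) (hy : y ∈ Γ j) :
    ⁅x, y⁆ ∈ Γ (i + j) :=
  hΓ.commutator_le i j (Subgroup.commutator_mem_commutator hx hy)

lemma normal (hΓ : IsCommFiltration Γ) (i : ℕ) : (Γ i).Normal := by
  rw [← Subgroup.commutator_top_left_le_iff, ← hΓ.zero]
  simpa using hΓ.commutator_le 0 i

/-- Passing to every `d`-th term of a filtration. -/
lemma mul_left (hΓ : IsCommFiltration Γ) (d : ℕ) : IsCommFiltration fun i => Γ (d * i) where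
  zero := by simpa using hΓ.zero
  antitone _ _ h := hΓ.antitone (Nat.mul_le_mul_left d h)
  commutator_le i j := by simpa [mul_add] using hΓ.commutator_le (d * i) (d * j)

end IsCommFiltration

/-! ### Polynomial sequences -/

/-- The difference operator on sequences in a group. -/
def seqDiff {G : Type u} [Group G] (g : ℕ → G) : ℕ → G := fun n => (g n)⁻¹ * g (n + 1)

/-- `g` is polynomial of degree shift `k`, tested on the first `m` iterated differences. -/
def IsPolyUpTo {G : Type u} [Group G] (Γ : ℕ → Subgroup G) : ℕ → ℕ → (ℕ → G) → Prop
  | 0, k, g => ∀ n, g n ∈ Γ k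
  | m + 1, k, g => (∀ n, g n ∈ Γ k) ∧ IsPolyUpTo Γ m (k + 1) (seqDiff g)

section Poly

variable {G : Type u} [Group G] {Γ : ℕ → Subgroup G}

lemma IsPolyUpTo.mem {m k : ℕ} {g : ℕ → G} (h : IsPolyUpTo Γ m k g) (n : ℕ) : g n ∈ Γ k := by
  cases m with
  | zero => exact h n
  | succ m => exact h.1 n

lemma IsPolyUpTo.of_succ {m k : ℕ} {g : ℕ → G} (h : IsPolyUpTo Γ (m + 1) k g) :
    IsPolyUpTo Γ m k g := by
  induction m generalizing k g with
  | zero => exact h.1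
  | succ m ih => exact ⟨h.1, ih h.2⟩

lemma IsPolyUpTo.mono (hΓ : IsCommFiltration Γ) {m k l : ℕ} {g : ℕ → G} (h : IsPolyUpTo Γ m k g)
    (hl : l ≤ k) : IsPolyUpTo Γ m l g := by
  induction m generalizing k l g with
  | zero => exact fun n => hΓ.antitone hl (h n)
  | succ m ih => exact ⟨fun n => hΓ.antitone hl (h.1 n), ih h.2 (by omega)⟩

lemma seqDiff_mul (g h : ℕ → G) : seqDiff (g * h) = h⁻¹ * seqDiff g * h * seqDiff h := by
  funext n; simp [seqDiff, mul_assoc]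

lemma seqDiff_inv (g : ℕ → G) : seqDiff g⁻¹ = g * (seqDiff g)⁻¹ * g⁻¹ := by
  funext n; simp [seqDiff, mul_assoc]

lemma seqDiff_commutator (g h : ℕ → G) :
    seqDiff ⁅g, h⁆ = ⁅g, h⁆⁻¹ * (g * ⁅seqDiff g, h * seqDiff h⁆ * g⁻¹) * ⁅g, h⁆⁻¹⁻¹ *
      (h * ⁅g, seqDiff h⁆ * h⁻¹) := by
  funext n; simp [seqDiff, commutatorElement_def, mul_assoc]

/-- The three closure properties need one another: each difference formula yields conjugates and
commutators of sequences for which one difference fewer must be tested. Hence one simultaneous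
induction on `m`. -/
lemma IsPolyUpTo.mul_inv_commutator (hΓ : IsCommFiltration Γ) (m : ℕ) :
    (∀ k g h, IsPolyUpTo Γ m k g → IsPolyUpTo Γ m k h → IsPolyUpTo Γ m k (g * h)) ∧
    (∀ k g, IsPolyUpTo Γ m k g → IsPolyUpTo Γ m k g⁻¹) ∧
    (∀ j k g h, IsPolyUpTo Γ m j g → IsPolyUpTo Γ m k h → IsPolyUpTo Γ m (j + k) ⁅g, h⁆) := by
  induction m with
  | zero =>
    exact ⟨fun k g h hg hh n => mul_mem (hg n) (hh n), fun k g hg n => inv_mem (hg n),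
      fun j k g h hg hh n => hΓ.commutator_mem (hg n) (hh n)⟩
  | succ m ih =>
    obtain ⟨hmul, hinv, hcomm⟩ := ih
    have hconj : ∀ {r s : ℕ} {c a : ℕ → G}, IsPolyUpTo Γ m r c → IsPolyUpTo Γ m s a →
        IsPolyUpTo Γ m r (a * c * a⁻¹) := by
      intro r s c a hc ha
      have : a * c * a⁻¹ = ⁅a, c⁆ * c := by simp [commutatorElement_def]
      rw [this]
      exact hmul _ _ _ ((hcomm _ _ _ _ ha hc).mono hΓ (by omega)) hc
    refine ⟨fun k g h hg hh => ⟨fun n => mul_mem (hg.1 n) (hh.1 n), ?_⟩,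
      fun k g hg => ⟨fun n => inv_mem (hg.1 n), ?_⟩,
      fun j k g h hg hh => ⟨fun n => hΓ.commutator_mem (hg.1 n) (hh.1 n), ?_⟩⟩
    · rw [seqDiff_mul]
      have := hconj hg.2 (hinv _ _ hh.of_succ)
      rw [inv_inv] at this
      exact hmul _ _ _ this hh.2
    · rw [seqDiff_inv]
      exact hconj (hinv _ _ hg.2) hg.of_succ
    · rw [seqDiff_commutator]
      have hgh := hcomm _ _ _ _ hg.of_succ hh.of_succ
      have h1 := hcomm _ _ _ _ hg.2 (hmul _ _ _ hh.of_succ (hh.2.mono hΓ (Nat.le_succ k)))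
      have h2 := hcomm _ _ _ _ hg.of_succ hh.2
      refine hmul _ _ _ (hconj (hconj ?_ hg.of_succ) (hinv _ _ hgh)) (hconj ?_ hh.of_succ)
      · exact h1.mono hΓ (by omega)
      · exact h2.mono hΓ (by omega)

/-- The group of polynomial sequences of degree shift `k`: those whose `i`-th differences take
values in `Γ (k + i)`. -/
def polySeq (hΓ : IsCommFiltration Γ) (k : ℕ) : Subgroup (ℕ → G) where
  carrier := {g | ∀ m, IsPolyUpTo Γ m k g}
  mul_mem' hg hh m := (IsPolyUpTo.mul_inv_commutator hΓ m).1 _ _ _ (hg m) (hh m)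
  inv_mem' hg m := (IsPolyUpTo.mul_inv_commutator hΓ m).2.1 _ _ (hg m)
  one_mem' m := by
    induction m generalizing k with
    | zero => exact fun _ => one_mem _
    | succ m ih =>
      refine ⟨fun _ => one_mem _, ?_⟩
      have : seqDiff (1 : ℕ → G) = 1 := by funext n; simp [seqDiff]
      rw [this]; exact ih _

variable (hΓ : IsCommFiltration Γ)

lemma polySeq_mono {k l : ℕ} (h : l ≤ k) : polySeq hΓ k ≤ polySeq hΓ l :=
  fun _ hg m => (hg m).mono hΓ h

lemma polySeq_apply_mem {k : ℕ} {g : ℕ → G} (hg : g ∈ polySeq hΓ k) (n : ℕ) : g n ∈ Γ k :=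
  (hg 0).mem n

lemma seqDiff_mem_polySeq {k : ℕ} {g : ℕ → G} (hg : g ∈ polySeq hΓ k) :
    seqDiff g ∈ polySeq hΓ (k + 1) :=
  fun m => (hg (m + 1)).2

lemma iterate_seqDiff_mem_polySeq {k : ℕ} {g : ℕ → G} (hg : g ∈ polySeq hΓ k) (j : ℕ) :
    seqDiff^[j] g ∈ polySeq hΓ (k + j) := by
  induction j generalizing k g with
  | zero => exact hg
  | succ j ih =>
    rw [Function.iterate_succ_apply, add_comm j 1, ← add_assoc]
    exact ih (seqDiff_mem_polySeq hΓ hg)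

lemma commutator_mem_polySeq {j k : ℕ} {g h : ℕ → G} (hg : g ∈ polySeq hΓ j)
    (hh : h ∈ polySeq hΓ k) : ⁅g, h⁆ ∈ polySeq hΓ (j + k) :=
  fun m => (IsPolyUpTo.mul_inv_commutator hΓ m).2.2 _ _ _ _ (hg m) (hh m)

lemma mem_polySeq_of_seqDiff {k : ℕ} {g : ℕ → G} (h0 : ∀ n, g n ∈ Γ k)
    (hD : seqDiff g ∈ polySeq hΓ (k + 1)) : g ∈ polySeq hΓ k := by
  intro m
  cases m with
  | zero => exact h0
  | succ m => exact ⟨h0, hD m⟩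

lemma seqDiff_const (a : G) : seqDiff (fun _ => a) = 1 := by
  funext n; simp [seqDiff]

@[simp] lemma seqDiff_one : seqDiff (1 : ℕ → G) = 1 := seqDiff_const 1

lemma iterate_seqDiff_one (j : ℕ) : seqDiff^[j] (1 : ℕ → G) = 1 :=
  Function.iterate_fixed seqDiff_one j

lemma const_mem_polySeq {k : ℕ} {a : G} (ha : a ∈ Γ k) : (fun _ => a) ∈ polySeq hΓ k := by
  refine mem_polySeq_of_seqDiff hΓ (fun _ => ha) ?_
  rw [seqDiff_const]; exact one_mem _

lemma seqDiff_pow_choose_succ (a : G) (j : ℕ) :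
    seqDiff (fun n => a ^ n.choose (j + 1)) = fun n => a ^ n.choose j := by
  funext n
  simp only [seqDiff, Nat.choose_succ_succ' n j]
  rw [add_comm (n.choose j), pow_add, inv_mul_cancel_left]

lemma pow_choose_mem_polySeq {k j : ℕ} {a : G} (ha : a ∈ Γ (k + j)) :
    (fun n => a ^ n.choose j) ∈ polySeq hΓ k := by
  induction j generalizing k with
  | zero => simpa using const_mem_polySeq hΓ ha
  | succ j ih =>
    refine mem_polySeq_of_seqDiff hΓ
      (fun n => pow_mem (hΓ.antitone (Nat.le_add_right _ _) ha) _) ?_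
    rw [seqDiff_pow_choose_succ]
    exact ih (by convert ha using 2; omega)

lemma iterate_seqDiff_pow_choose (a : G) {j i : ℕ} (hij : j < i) :
    seqDiff^[i] (fun n => a ^ n.choose j) = 1 := by
  induction j generalizing i with
  | zero =>
    obtain ⟨i, rfl⟩ := Nat.exists_eq_add_of_lt hij
    rw [Nat.zero_add, Function.iterate_succ_apply]
    simp only [Nat.choose_zero_right, pow_one]
    rw [seqDiff_const, iterate_seqDiff_one]
  | succ j ih =>
    obtain ⟨i, rfl⟩ : ∃ l, i = l + 1 := ⟨i - 1, by omega⟩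
    rw [Function.iterate_succ_apply, seqDiff_pow_choose_succ]
    exact ih (by omega)

/-- If a sequence vanishes at the `n` places from `s` on, its `n`-th difference at `s` is its next
value. -/
lemma iterate_seqDiff_eq_of_vanish {g : ℕ → G} {n s : ℕ} (h : ∀ i < n, g (s + i) = 1) :
    seqDiff^[n] g s = g (s + n) := by
  induction n generalizing g with
  | zero => rfl
  | succ n ih =>
    rw [Function.iterate_succ_apply, ih]
    · simp only [seqDiff]; rw [h n (by omega), inv_one, one_mul, add_assoc]
    · intro i hi
      simp only [seqDiff]
      rw [h i (by omega), add_assoc, h (i + 1) (by omega), inv_one, one_mul]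

/-- The difference operator is multiplicative to leading order. -/
lemma seqDiff_congr {k : ℕ} (hk : 1 ≤ k) {f g h : ℕ → G} (hg : g ∈ polySeq hΓ k)
    (hh : h ∈ polySeq hΓ k) (hf : (g * h)⁻¹ * f ∈ polySeq hΓ (k + 1)) :
    (seqDiff g * seqDiff h)⁻¹ * seqDiff f ∈ polySeq hΓ (k + 2) := by
  set w := (g * h)⁻¹ * f with hw
  have hfe : f = g * (h * w) := by rw [hw]; group
  have key : (seqDiff g * seqDiff h)⁻¹ * seqDiff f =
      (seqDiff h)⁻¹ * ⁅(seqDiff g)⁻¹, (h * w)⁻¹⁆ * (seqDiff h)⁻¹⁻¹ *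
        (⁅(seqDiff h)⁻¹, w⁻¹⁆ * seqDiff w) := by
    rw [hfe, seqDiff_mul, seqDiff_mul]; simp only [commutatorElement_def]; group
  have hw' : w ∈ polySeq hΓ k := polySeq_mono hΓ (Nat.le_succ k) hf
  have hDh := seqDiff_mem_polySeq hΓ hh
  -- This is where `1 ≤ k` enters: the commutator has shift `2k + 1 ≥ k + 2`.
  have h1 : ⁅(seqDiff g)⁻¹, (h * w)⁻¹⁆ ∈ polySeq hΓ (k + 2) :=
    polySeq_mono hΓ (by omega) (commutator_mem_polySeq hΓ
      (inv_mem (seqDiff_mem_polySeq hΓ hg)) (inv_mem (mul_mem hh hw')))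
  have h2 : ⁅(seqDiff h)⁻¹, w⁻¹⁆ ∈ polySeq hΓ (k + 2) :=
    polySeq_mono hΓ (by omega) (commutator_mem_polySeq hΓ (inv_mem hDh) (inv_mem hf))
  rw [key]
  refine mul_mem ?_ (mul_mem h2 (seqDiff_mem_polySeq hΓ hf))
  have e : (seqDiff h)⁻¹ * ⁅(seqDiff g)⁻¹, (h * w)⁻¹⁆ * (seqDiff h)⁻¹⁻¹ =
      ⁅(seqDiff h)⁻¹, ⁅(seqDiff g)⁻¹, (h * w)⁻¹⁆⁆ * ⁅(seqDiff g)⁻¹, (h * w)⁻¹⁆ := by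
    rw [commutatorElement_def (seqDiff h)⁻¹]; group
  rw [e]
  exact mul_mem (polySeq_mono hΓ (by omega) (commutator_mem_polySeq hΓ (inv_mem hDh) h1)) h1

lemma iterate_seqDiff_congr {k : ℕ} (hk : 1 ≤ k) {f g h : ℕ → G} (hg : g ∈ polySeq hΓ k)
    (hh : h ∈ polySeq hΓ k) (hf : (g * h)⁻¹ * f ∈ polySeq hΓ (k + 1)) (j : ℕ) :
    (seqDiff^[j] g * seqDiff^[j] h)⁻¹ * seqDiff^[j] f ∈ polySeq hΓ (k + j + 1) := by
  induction j generalizing k f g h with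
  | zero => exact hf
  | succ j ih =>
    simp only [Function.iterate_succ_apply]
    have := ih (k := k + 1) (by omega) (seqDiff_mem_polySeq hΓ hg) (seqDiff_mem_polySeq hΓ hh)
      (seqDiff_congr hΓ hk hg hh hf)
    convert this using 2; omega

lemma iterate_seqDiff_mul_apply {k : ℕ} (hk : 1 ≤ k) {g h : ℕ → G} (hg : g ∈ polySeq hΓ k)
    (hh : h ∈ polySeq hΓ k) (j n : ℕ) :
    (seqDiff^[j] g n * seqDiff^[j] h n)⁻¹ * seqDiff^[j] (g * h) n ∈ Γ (k + j + 1) :=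
  polySeq_apply_mem hΓ (iterate_seqDiff_congr hΓ hk hg hh (by simp [one_mem]) j) n

/-- A polynomial sequence with trivial first two values, evaluated at a prime `p`. -/
lemma polySeq_apply_prime {p : ℕ} (hp : p.Prime) {k : ℕ} {g : ℕ → G} (hg : g ∈ polySeq hΓ k)
    (h0 : g 0 = 1) (h1 : g 1 = 1) (hpow : ∀ x ∈ Γ (k + 2), x ^ p = 1) :
    g p ∈ Γ (k + p) ∧ (1 ≤ k → (seqDiff^[p] g 0)⁻¹ * g p ∈ Γ (k + p + 1)) := by
  -- Newton interpolation: the values at `2, …, p - 1` are cleared one by one, by multiplying with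
  -- powers of binomial exponent, keeping the value at `p` and the leading term of the `p`-th
  -- difference.
  have key : ∀ m, 2 ≤ m → m ≤ p → ∃ r ∈ polySeq hΓ k, (∀ n < m, r n = 1) ∧ r p = g p ∧
      (1 ≤ k → (seqDiff^[p] g 0)⁻¹ * seqDiff^[p] r 0 ∈ Γ (k + p + 1)) := by
    intro m hm
    induction m, hm using Nat.le_induction with
    | base =>
      refine fun _ => ⟨g, hg, fun n hn => ?_, rfl, fun _ => by simp [one_mem]⟩
      interval_cases n <;> assumption
    | succ m hm ih =>
      intro hmp
      obtain ⟨r, hr, hr0, hrp, hrD⟩ := ih (by omega)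
      have ha : r m ∈ Γ (k + m) := by
        have := iterate_seqDiff_eq_of_vanish (g := r) (n := m) (s := 0) (by simpa using hr0)
        rw [zero_add] at this
        rw [← this]
        exact polySeq_apply_mem hΓ (iterate_seqDiff_mem_polySeq hΓ hr m) 0
      set b : ℕ → G := fun n => (r m)⁻¹ ^ n.choose m with hb
      have hbm : b ∈ polySeq hΓ k := pow_choose_mem_polySeq hΓ (inv_mem ha)
      refine ⟨b * r, mul_mem hbm hr, fun n hn => ?_, ?_, fun hk => ?_⟩
      · rcases Nat.lt_succ_iff_lt_or_eq.mp hn with h | rfl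
        · simp [hb, hr0 n h, Nat.choose_eq_zero_of_lt h]
        · simp [hb]
      -- `p` divides the binomial coefficient and `r m` has trivial `p`-th power, so the correction
      -- is invisible at `p`. Only `m ≥ 2` occurs, whence `Γ (k + 2)` in `hpow`.
      · obtain ⟨c, hc⟩ := hp.dvd_choose_self (by omega : m ≠ 0) (by omega : m < p)
        have : (r m)⁻¹ ^ p.choose m = 1 := by
          rw [hc, pow_mul, hpow _ (inv_mem (hΓ.antitone (by omega) ha)), one_pow]
        simp only [hb, Pi.mul_apply, this, one_mul, hrp]
      -- The correction has degree `m < p`, so its own `p`-th difference is trivial.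
      · have h2 := iterate_seqDiff_mul_apply hΓ hk hbm hr p 0
        rw [hb, iterate_seqDiff_pow_choose _ (by omega : m < p), ← hb] at h2
        simp only [Pi.one_apply, one_mul] at h2
        have := mul_mem (hrD hk) h2
        rwa [mul_assoc, mul_inv_cancel_left] at this
  obtain ⟨r, hr, hr0, hrp, hrD⟩ := key p hp.two_le le_rfl
  have hrp' : seqDiff^[p] r 0 = g p := by
    rw [iterate_seqDiff_eq_of_vanish (by simpa using hr0), zero_add, hrp]
  rw [hrp'] at hrD
  exact ⟨hrp' ▸ polySeq_apply_mem hΓ (iterate_seqDiff_mem_polySeq hΓ hr p) 0, hrD⟩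

end Poly

/-! ### Conjugation sequences and Engel commutators -/

section Engel

variable {G : Type u} [Group G] {Γ : ℕ → Subgroup G}

/-- The sequence of conjugates `xⁿ y x⁻ⁿ`. -/
def conjSeq (x y : G) : ℕ → G := fun n => x ^ n * y * (x ^ n)⁻¹

/-- The iterated commutators `e₀ = y`, `eⱼ₊₁ = [eⱼ⁻¹, x]`. -/
def engelComm (x y : G) : ℕ → G
  | 0 => y
  | j + 1 => ⁅(engelComm x y j)⁻¹, x⁆

lemma engelComm_succ' (x y : G) (j : ℕ) :
    engelComm x y (j + 1) = engelComm x ⁅y⁻¹, x⁆ j := by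
  induction j with
  | zero => rfl
  | succ j ih => rw [engelComm, ih, engelComm]

lemma map_engelComm {H : Type u} [Group H] (f : G →* H) (x y : G) (j : ℕ) :
    f (engelComm x y j) = engelComm (f x) (f y) j := by
  induction j with
  | zero => rfl
  | succ j ih => rw [engelComm, map_commutatorElement, map_inv, ih, engelComm]

lemma seqDiff_conjSeq (x y : G) : seqDiff (conjSeq x y) = conjSeq x ⁅y⁻¹, x⁆ := by
  funext n
  simp only [seqDiff, conjSeq, commutatorElement_def, pow_succ]; group

lemma iterate_seqDiff_conjSeq (x y : G) (j : ℕ) :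
    seqDiff^[j] (conjSeq x y) = conjSeq x (engelComm x y j) := by
  induction j generalizing y with
  | zero => rfl
  | succ j ih => rw [Function.iterate_succ_apply, seqDiff_conjSeq, ih, engelComm_succ']

lemma engelComm_mem (hΓ : IsCommFiltration Γ) (h1 : Γ 1 = ⊤) {k : ℕ} {x y : G} (hy : y ∈ Γ k)
    (j : ℕ) : engelComm x y j ∈ Γ (k + j) := by
  induction j with
  | zero => exact hy
  | succ j ih =>
    rw [← add_assoc]
    exact hΓ.commutator_mem (inv_mem ih) (by rw [h1]; trivial)

lemma conjSeq_mem_polySeq (hΓ : IsCommFiltration Γ) (h1 : Γ 1 = ⊤) {k : ℕ} {x y : G}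
    (hy : y ∈ Γ k) : conjSeq x y ∈ polySeq hΓ k := by
  intro m
  induction m generalizing k y with
  | zero => exact fun n => (hΓ.normal k).conj_mem _ hy _
  | succ m ih =>
    refine ⟨fun n => (hΓ.normal k).conj_mem _ hy _, ?_⟩
    rw [seqDiff_conjSeq]
    exact ih (hΓ.commutator_mem (inv_mem hy) (by rw [h1]; trivial))

lemma mk_eq_one_of_mem {N : Subgroup G} [N.Normal] {x : G} (hx : x ∈ N) : (x : G ⧸ N) = 1 :=
  (QuotientGroup.eq_one_iff x).mpr hx

end Engel

/-! ### The lower central filtration -/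

section LowerCentral

variable {G : Type u} [Group G]

/-- The three subgroups lemma modulo a normal subgroup. -/
lemma commutator_commutator_le_of_rotate {H₁ H₂ H₃ N : Subgroup G} [N.Normal]
    (h1 : ⁅⁅H₂, H₃⁆, H₁⁆ ≤ N) (h2 : ⁅⁅H₃, H₁⁆, H₂⁆ ≤ N) : ⁅⁅H₁, H₂⁆, H₃⁆ ≤ N := by
  have key : ∀ K : Subgroup G, K ≤ N ↔ K.map (QuotientGroup.mk' N) = ⊥ := fun K => by
    rw [Subgroup.map_eq_bot_iff, QuotientGroup.ker_mk']
  rw [key] at h1 h2 ⊢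
  simp only [Subgroup.map_commutator] at h1 h2 ⊢
  exact Subgroup.commutator_commutator_eq_bot_of_rotate h1 h2

lemma commutator_lowerCentralSeries_le (i j : ℕ) :
    ⁅(⊤ : Subgroup G).lowerCentralSeries i, (⊤ : Subgroup G).lowerCentralSeries j⁆ ≤
      (⊤ : Subgroup G).lowerCentralSeries (i + j + 1) := by
  induction j generalizing i with
  | zero => exact le_rfl
  | succ j ih =>
    rw [Subgroup.commutator_comm, Subgroup.lowerCentralSeries_succ ⊤ j]
    apply commutator_commutator_le_of_rotate
    · rw [Subgroup.commutator_comm ⊤, ← Subgroup.lowerCentralSeries_succ]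
      exact (ih (i + 1)).trans_eq (by congr 1; omega)
    · exact Subgroup.commutator_mono (ih i) le_rfl

/-- The lower central series indexed from one: `γ₀ = γ₁ = G`, `γᵢ₊₁ = [γᵢ, G]`. -/
def lcFiltration (G : Type u) [Group G] (i : ℕ) : Subgroup G :=
  (⊤ : Subgroup G).lowerCentralSeries (i - 1)

lemma isCommFiltration_lcFiltration (G : Type u) [Group G] :
    IsCommFiltration (lcFiltration G) where
  zero := rfl
  antitone _ _ h := Subgroup.lowerCentralSeries_antitone _ (by omega)
  commutator_le i j := by
    rcases i with _ | i
    · rw [zero_add]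
      have : (lcFiltration G j).Normal := by unfold lcFiltration; infer_instance
      exact Subgroup.commutator_le_right _ _
    rcases j with _ | j
    · have : (lcFiltration G (i + 1)).Normal := by unfold lcFiltration; infer_instance
      exact Subgroup.commutator_le_left _ _
    · refine (commutator_lowerCentralSeries_le i j).trans_eq ?_
      unfold lcFiltration; congr 1; omega

end LowerCentral

/-! ### Powers of commutators -/

section CommutatorPowers

variable {G : Type u} [Group G]

lemma commutator_pow_left {a b : G} (h : Commute ⁅a, b⁆ a) (n : ℕ) : ⁅a ^ n, b⁆ = ⁅a, b⁆ ^ n := by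
  induction n with
  | zero => simp
  | succ n ih =>
    rw [pow_succ', commutatorElement_mul_left_eq_conj_mul, ih, ← (h.pow_left n).eq,
      mul_inv_cancel_right, pow_succ]

lemma commutator_pow_right {a b : G} (h : Commute ⁅a, b⁆ b) (n : ℕ) :
    ⁅a, b ^ n⁆ = ⁅a, b⁆ ^ n := by
  have h' : Commute ⁅b, a⁆ b := by rw [← commutatorElement_inv]; exact h.inv_left
  rw [← commutatorElement_inv, commutator_pow_left h', ← inv_pow, commutatorElement_inv]

lemma mk_commute_of_commutator_mem {N : Subgroup G} [N.Normal] {a b : G} (h : ⁅a, b⁆ ∈ N) :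
    Commute (a : G ⧸ N) (b : G ⧸ N) := by
  rw [← commutatorElement_eq_one_iff_commute]
  exact mk_eq_one_of_mem h

end CommutatorPowers

/-! ### The Engel identity in groups of prime exponent -/

section EngelIdentity

variable {G : Type u} [Group G] {Γ : ℕ → Subgroup G}

/-- Engel commutators are homogeneous in the repeated entry, to leading order. -/
lemma engelComm_pow_mem (hΓ : IsCommFiltration Γ) (h1 : Γ 1 = ⊤) (x y : G) (i j : ℕ) :
    (engelComm x y j ^ i ^ j)⁻¹ * engelComm (x ^ i) y j ∈ Γ (j + 2) := by
  induction j with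
  | zero => simp [engelComm, one_mem]
  | succ j ih =>
    have hN := hΓ.normal (j + 1 + 2)
    have hall : ∀ z : G, z ∈ Γ 1 := fun z => by rw [h1]; trivial
    -- The error `w` and the next Engel commutator are central modulo `Γ (j + 3)`, so there the
    -- error drops out and the two exponents `i ^ j` and `i` multiply.
    set w := (engelComm x y j ^ i ^ j)⁻¹ * engelComm (x ^ i) y j with hw
    have hE' : engelComm (x ^ i) y j = engelComm x y j ^ i ^ j * w := by rw [hw]; group
    have hC : ⁅(engelComm x y j)⁻¹, x⁆ ∈ Γ (j + 2) := by
      have := hΓ.commutator_mem (inv_mem (engelComm_mem hΓ h1 (x := x) (hall y) j)) (hall x)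
      rwa [show 1 + j + 1 = j + 2 by ring] at this
    have hcomm : ∀ {c : G}, c ∈ Γ (j + 2) → ∀ z : G,
        Commute (c : G ⧸ Γ (j + 1 + 2)) (z : G ⧸ Γ (j + 1 + 2)) := fun hc z =>
      mk_commute_of_commutator_mem (hΓ.commutator_mem (i := j + 2) (j := 1) hc (hall z))
    rw [← QuotientGroup.eq_one_iff]
    have e1 : ((⁅(engelComm x y j)⁻¹, x⁆ : G) : G ⧸ Γ (j + 1 + 2)) =
      ⁅((engelComm x y j : G) : G ⧸ Γ (j + 1 + 2))⁻¹, (x : G ⧸ Γ (j + 1 + 2))⁆ := rfl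
    have hCE := hcomm hC (engelComm x y j)
    have hCx := hcomm hC x
    rw [e1] at hCE hCx
    have e2 : ((engelComm (x ^ i) y (j + 1) : G) : G ⧸ Γ (j + 1 + 2)) =
        ⁅((engelComm x y j : G) : G ⧸ Γ (j + 1 + 2))⁻¹, (x : G ⧸ Γ (j + 1 + 2))⁆ ^ i ^ (j + 1) := by
      have : ((engelComm (x ^ i) y (j + 1) : G) : G ⧸ Γ (j + 1 + 2)) =
        ⁅((engelComm (x ^ i) y j : G) : G ⧸ Γ (j + 1 + 2))⁻¹, (x : G ⧸ Γ (j + 1 + 2)) ^ i⁆ := rfl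
      rw [this, hE', QuotientGroup.mk_mul, mul_inv_rev, commutatorElement_mul_left_eq_conj_mul]
      have hw1 := ((hcomm ih x).pow_right i).inv_left
      rw [hw1.commutator_eq, mul_one]
      rw [QuotientGroup.mk_pow, ← inv_pow, commutator_pow_left, commutator_pow_right hCx,
        ← pow_mul, pow_succ, mul_comm i]
      · exact (((hcomm ih ⁅(engelComm x y j)⁻¹, x⁆).inv_left.pow_right _).eq ▸ by
          rw [mul_inv_cancel_right]; rfl)
      · rw [commutator_pow_right hCx]
        exact hCE.inv_right.pow_left _
    rw [QuotientGroup.mk_mul, e2, QuotientGroup.mk_inv, QuotientGroup.mk_pow, engelComm, e1,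
      inv_mul_cancel]

/-- The sequence `a ↦ (xᵃ y)ʳ x⁻ᵃʳ`. -/
def powCollectSeq (x y : G) (r : ℕ) : ℕ → G := fun a => (x ^ a * y) ^ r * (x ^ (a * r))⁻¹

/-- Iterating, the sequence is the product of the conjugation sequences of `y` by `x, x², …, xʳ`. -/
lemma powCollectSeq_succ (x y : G) (r : ℕ) :
    powCollectSeq x y (r + 1) = powCollectSeq x y r * conjSeq (x ^ (r + 1)) y := by
  funext a
  simp only [powCollectSeq, conjSeq, Pi.mul_apply]
  rw [← pow_mul, mul_comm (r + 1) a, mul_add_one a r, pow_add x, pow_succ (x ^ a * y)]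
  group

lemma powCollectSeq_mem (hΓ : IsCommFiltration Γ) (h1 : Γ 1 = ⊤) (x y : G) (r : ℕ) :
    powCollectSeq x y r ∈ polySeq hΓ 1 := by
  induction r with
  | zero =>
    have : powCollectSeq x y 0 = 1 := by funext a; simp [powCollectSeq]
    rw [this]; exact one_mem _
  | succ r ih =>
    rw [powCollectSeq_succ]
    exact mul_mem ih (conjSeq_mem_polySeq hΓ h1 (by rw [h1]; trivial))

/-- To leading order the difference operator is multiplicative, and the factor from `xⁱ` contributes
the Engel commutator to the power `i ^ j`. -/
lemma iterate_seqDiff_powCollectSeq (hΓ : IsCommFiltration Γ) (h1 : Γ 1 = ⊤) (x y : G) (j r : ℕ) :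
    (engelComm x y j ^ (∑ i ∈ Finset.range r, (i + 1) ^ j))⁻¹ *
      seqDiff^[j] (powCollectSeq x y r) 0 ∈ Γ (j + 2) := by
  have hN := hΓ.normal (j + 2)
  induction r with
  | zero =>
    have : powCollectSeq x y 0 = 1 := by funext a; simp [powCollectSeq]
    simp [this, iterate_seqDiff_one, one_mem]
  | succ r ih =>
    have h2 := iterate_seqDiff_mul_apply hΓ le_rfl (powCollectSeq_mem hΓ h1 x y r)
      (conjSeq_mem_polySeq hΓ h1 (x := x ^ (r + 1)) (y := y) (by rw [h1]; trivial)) j 0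
    rw [← powCollectSeq_succ, iterate_seqDiff_conjSeq, show 1 + j + 1 = j + 2 by ring] at h2
    have h3 := engelComm_pow_mem hΓ h1 x y (r + 1) j
    rw [← QuotientGroup.eq] at ih h2 h3 ⊢
    rw [← h2, QuotientGroup.mk_mul, ← ih, Finset.sum_range_succ, pow_add, QuotientGroup.mk_mul, h3]
    simp [conjSeq]

lemma eq_one_of_pow_eq_one_of_coprime {a : G} {m n : ℕ} (hm : a ^ m = 1) (hn : a ^ n = 1)
    (h : m.Coprime n) : a = 1 := by
  rw [← orderOf_eq_one_iff, ← Nat.dvd_one, ← h]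
  exact Nat.dvd_gcd (orderOf_dvd_of_pow_eq_one hm) (orderOf_dvd_of_pow_eq_one hn)

/-- By Fermat the first `p - 1` terms are 1 and the last is 0 modulo `p`, so the sum is `-1`. -/
lemma coprime_sum_pow_pred {p : ℕ} (hp : p.Prime) :
    (∑ i ∈ Finset.range p, (i + 1) ^ (p - 1)).Coprime p := by
  have := Fact.mk hp
  rw [Nat.coprime_comm, hp.coprime_iff_not_dvd, ← ZMod.natCast_eq_zero_iff]
  obtain ⟨q, rfl⟩ : ∃ q, p = q + 1 := ⟨p - 1, by have := hp.pos; omega⟩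
  have hq : q ≠ 0 := by rintro rfl; exact hp.ne_one rfl
  rw [Finset.sum_range_succ]
  push_cast
  have hz : (q : ZMod (q + 1)) + 1 = 0 := by exact_mod_cast ZMod.natCast_self (q + 1)
  have : ∀ i ∈ Finset.range q, ((i : ZMod (q + 1)) + 1) ^ (q + 1 - 1) = 1 := by
    intro i hi
    apply ZMod.pow_card_sub_one_eq_one
    have : ((i + 1 : ℕ) : ZMod (q + 1)) ≠ 0 := by
      rw [Ne, ZMod.natCast_eq_zero_iff]
      intro h
      have := Nat.le_of_dvd (by omega) h
      have := Finset.mem_range.mp hi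
      omega
    exact_mod_cast this
  rw [Nat.add_sub_cancel] at this
  rw [Finset.sum_congr rfl this, hz]
  simp only [Finset.sum_const, Finset.card_range, nsmul_eq_mul, mul_one,
    zero_pow hq, add_zero]
  intro h0
  rw [h0, zero_add] at hz
  exact one_ne_zero hz

/-- In a group of prime exponent `p`, the commutator `[y, x, …, x]` with `p - 1` entries `x` lies
in the `(p + 1)`-st term of the lower central series. -/
lemma engelComm_mem_of_exponent_prime {p : ℕ} (hp : p.Prime) (hpow : ∀ z : G, z ^ p = 1)
    (x y : G) : engelComm x y (p - 1) ∈ lcFiltration G (p + 1) := by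
  have hΓ := isCommFiltration_lcFiltration G
  have hN := hΓ.normal (p + 1)
  -- Exponent `p` makes the whole sequence trivial, hence also its `(p - 1)`-st difference; a power
  -- of the Engel commutator prime to `p` is therefore trivial modulo `γ_{p+1}`.
  have hone : powCollectSeq x y p = 1 := by
    funext a; simp [powCollectSeq, pow_mul, hpow]
  have h := iterate_seqDiff_powCollectSeq hΓ rfl x y (p - 1) p
  rw [hone, iterate_seqDiff_one, show p - 1 + 2 = p + 1 by have := hp.pos; omega,
    Pi.one_apply, mul_one, inv_mem_iff] at h
  rw [← QuotientGroup.eq_one_iff] at h ⊢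
  refine eq_one_of_pow_eq_one_of_coprime (by simpa using h) (n := p) ?_ (coprime_sum_pow_pred hp)
  rw [← QuotientGroup.mk_pow, hpow, QuotientGroup.mk_one]

end EngelIdentity

/-! ### Central extensions of groups of exponent `p` and class at most `p` -/

section ExponentPrime

variable {L : Type u} [Group L]

/-- If `L / Z(L)` has prime exponent `p` and class at most `p`, the Engel commutators with `p`
repeated entries vanish in `L`. -/
lemma engelComm_prime_eq_one {p : ℕ} (hp : p.Prime)
    (hpow : ∀ x : L, x ^ p ∈ Subgroup.center L)
    (hlow : (⊤ : Subgroup L).lowerCentralSeries p ≤ Subgroup.center L) (x y : L) :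
    engelComm x y p = 1 := by
  set π := QuotientGroup.mk' (Subgroup.center L) with hπ
  have h1 : ∀ z : L ⧸ Subgroup.center L, z ^ p = 1 := by
    intro z
    obtain ⟨z, rfl⟩ := QuotientGroup.mk'_surjective _ z
    rw [← map_pow]
    exact mk_eq_one_of_mem (hpow z)
  have h2 := engelComm_mem_of_exponent_prime hp h1 (π x) (π y)
  have h3 : lcFiltration (L ⧸ Subgroup.center L) (p + 1) = ⊥ := by
    have htop : (⊤ : Subgroup L).map π = ⊤ :=
      Subgroup.map_top_of_surjective _ (QuotientGroup.mk'_surjective _)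
    rw [lcFiltration, Nat.add_sub_cancel, ← htop, ← Subgroup.map_lowerCentralSeries,
      Subgroup.map_eq_bot_iff, hπ, QuotientGroup.ker_mk']
    exact hlow
  rw [h3, Subgroup.mem_bot, ← map_engelComm] at h2
  have h4 : engelComm x y (p - 1) ∈ Subgroup.center L := (QuotientGroup.eq_one_iff _).mp h2
  obtain ⟨q, rfl⟩ : ∃ q, p = q + 1 := ⟨p - 1, by have := hp.pos; omega⟩
  rw [engelComm]
  apply Commute.commutator_eq
  exact (Subgroup.mem_center_iff.mp (inv_mem h4) x).symm

/-- In the coarser filtration `γ_{ij}` the sequence `(xy)⁻ⁿ xⁿ yⁿ` is polynomial and trivial at 0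
and 1, so its value at `p` lies in `γ_{ip}`, which is trivial because `ip ≥ 2p ≥ p + 2`. -/
lemma pow_prime_mul_of_mem_lcFiltration {p : ℕ} (hp : p.Prime)
    (hbot : lcFiltration L (p + 2) = ⊥) {i : ℕ} (hi : 2 ≤ i)
    (hexp : ∀ x ∈ lcFiltration L (i + 1), x ^ p = 1) {x y : L} (hx : x ∈ lcFiltration L i)
    (hy : y ∈ lcFiltration L i) : (x * y) ^ p = x ^ p * y ^ p := by
  have hγ := isCommFiltration_lcFiltration L
  have hΓ := hγ.mul_left i
  have hlin : ∀ z ∈ lcFiltration L i, (fun n => z ^ n) ∈ polySeq hΓ 0 := by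
    intro z hz
    have := pow_choose_mem_polySeq hΓ (k := 0) (j := 1) (a := z) (by simpa using hz)
    simpa using this
  set g : ℕ → L := (fun n => (x * y) ^ n)⁻¹ * ((fun n => x ^ n) * fun n => y ^ n) with hg
  have hgm : g ∈ polySeq hΓ 0 :=
    mul_mem (inv_mem (hlin _ (mul_mem hx hy))) (mul_mem (hlin _ hx) (hlin _ hy))
  have h := (polySeq_apply_prime hΓ hp hgm (by simp [hg]) (by simp [hg])
    (fun z hz => hexp z (hγ.antitone (by omega) hz))).1
  have hle : p + 2 ≤ i * (0 + p) := by
    have := hp.two_le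
    nlinarith
  have hval := hγ.antitone hle h
  rw [hbot, Subgroup.mem_bot] at hval
  simp only [hg, Pi.mul_apply, Pi.inv_apply] at hval
  exact inv_mul_eq_one.mp hval

/-- If `L / Z(L)` has prime exponent `p` and class at most `p`, then the commutator subgroup of `L`
has exponent dividing `p`. -/
theorem pow_prime_eq_one_of_mem_commutator {p : ℕ} (hp : p.Prime)
    (hpow : ∀ x : L, x ^ p ∈ Subgroup.center L)
    (hlow : (⊤ : Subgroup L).lowerCentralSeries p ≤ Subgroup.center L) {c : L}
    (hc : c ∈ commutator L) : c ^ p = 1 := by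
  have hγ := isCommFiltration_lcFiltration L
  have hbot : lcFiltration L (p + 2) = ⊥ := by
    change ⁅(⊤ : Subgroup L).lowerCentralSeries p, ⊤⁆ = ⊥
    rwa [Subgroup.commutator_top_right_eq_bot_iff_le_center]
  -- Downward induction along the lower central series, which stops at `γ_{p+2} = 1`; the exponent
  -- of `γ_{i+1}` feeds the polynomial argument for `γ_i`.
  have key : ∀ d i, 2 ≤ i → p + 2 ≤ i + d → ∀ x ∈ lcFiltration L i, x ^ p = 1 := by
    intro d
    induction d with
    | zero =>
      intro i _ hid x hx
      have := hγ.antitone hid hx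
      rw [hbot, Subgroup.mem_bot] at this
      rw [this, one_pow]
    | succ d ih =>
      intro i hi hid
      have hexp := ih (i + 1) (by omega) (by omega)
      obtain ⟨k, rfl⟩ : ∃ k, i = k + 2 := ⟨i - 2, by omega⟩
      have hgen : ∀ y ∈ lcFiltration L (k + 1), ∀ x : L, ⁅y⁻¹, x⁆ ^ p = 1 := by
        intro y hy x
        have hc : ⁅y⁻¹, x⁆ ∈ lcFiltration L (k + 2) :=
          hγ.commutator_mem (j := 1) (inv_mem hy) trivial
        -- The sequence used is `[y⁻¹, x]⁻ⁿ · y⁻¹ · xⁿ y x⁻ⁿ`. The first two factors have degree 1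
        -- and 0, below `p`, so only the conjugates contribute to its `p`-th difference, by an Engel
        -- commutator that vanishes.
        have ht : conjSeq x y ∈ polySeq hγ (k + 1) := conjSeq_mem_polySeq hγ rfl hy
        have hlin : (fun n => ⁅y⁻¹, x⁆⁻¹ ^ n) ∈ polySeq hγ (k + 1) := by
          simpa using pow_choose_mem_polySeq hγ (k := k + 1) (j := 1) (inv_mem hc)
        have hcst : (fun _ : ℕ => y⁻¹) ∈ polySeq hγ (k + 1) :=
          const_mem_polySeq hγ (inv_mem hy)
        have hb2 : ∀ z ∈ lcFiltration L (k + 1 + p + 1), z = 1 := fun z hz => by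
          have := hγ.antitone (by omega : p + 2 ≤ k + 1 + p + 1) hz
          rwa [hbot, Subgroup.mem_bot] at this
        have hD1 : seqDiff^[p] ((fun _ : ℕ => y⁻¹) * conjSeq x y) 0 = 1 := by
          have h := hb2 _ (iterate_seqDiff_mul_apply hγ (by omega) hcst ht p 0)
          rw [inv_mul_eq_one] at h
          rw [← h, iterate_seqDiff_conjSeq, engelComm_prime_eq_one hp hpow hlow]
          have := iterate_seqDiff_pow_choose y⁻¹ (j := 0) hp.pos
          simp only [Nat.choose_zero_right, pow_one] at this
          simp [this, conjSeq]
        have hD2 : seqDiff^[p] ((fun n => ⁅y⁻¹, x⁆⁻¹ ^ n) *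
            ((fun _ : ℕ => y⁻¹) * conjSeq x y)) 0 = 1 := by
          have h := hb2 _ (iterate_seqDiff_mul_apply hγ (by omega) hlin (mul_mem hcst ht) p 0)
          rw [inv_mul_eq_one] at h
          have := iterate_seqDiff_pow_choose ⁅y⁻¹, x⁆⁻¹ (j := 1) hp.one_lt
          simp only [Nat.choose_one_right] at this
          rw [← h, hD1, this, Pi.one_apply, one_mul]
        have h := hb2 _ ((polySeq_apply_prime hγ hp (mul_mem hlin (mul_mem hcst ht))
          (by simp [conjSeq]) (by simp [conjSeq, commutatorElement_def]; group)
          (fun z hz => hexp z (by convert hz using 2))).2 (by omega))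
        rw [hD2, inv_one, one_mul] at h
        -- Since `x ^ p` is central, the value at `p` is just `[y⁻¹, x]⁻ᵖ`.
        have hx : x ^ p * y * (x ^ p)⁻¹ = y := by
          rw [← Subgroup.mem_center_iff.mp (hpow x) y, mul_inv_cancel_right]
        simp only [Pi.mul_apply, conjSeq, hx, inv_mul_cancel, mul_one] at h
        rwa [inv_pow, inv_eq_one] at h
      intro x hx
      suffices x ∈ lcFiltration L (k + 2) ∧ x ^ p = 1 from this.2
      have hx' : x ∈ Subgroup.closure
          {g | ∃ a ∈ lcFiltration L (k + 1), ∃ b ∈ (⊤ : Subgroup L), ⁅a, b⁆ = g} := hx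
      induction hx' using Subgroup.closure_induction with
      | mem z hz =>
        obtain ⟨a, ha, b, -, rfl⟩ := hz
        refine ⟨hγ.commutator_mem (j := 1) ha trivial, ?_⟩
        simpa using hgen a⁻¹ (inv_mem ha) b
      | one => exact ⟨one_mem _, one_pow _⟩
      | mul a b ha hb iha ihb =>
        have iha := iha ha
        have ihb := ihb hb
        refine ⟨mul_mem iha.1 ihb.1, ?_⟩
        rw [pow_prime_mul_of_mem_lcFiltration hp hbot hi hexp iha.1 ihb.1, iha.2, ihb.2, one_mul]
      | inv a ha iha =>
        have iha := iha ha
        exact ⟨inv_mem iha.1, by rw [inv_pow, iha.2, inv_one]⟩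
  exact key p 2 le_rfl (by omega) c hc

end ExponentPrime

/-! ### Power maps along descending chains -/

section PowerChain

variable {K : Type u} [Group K]

lemma mul_pow_of_commute_commutator {x y : K} (hx : Commute ⁅y, x⁆ x) (hy : Commute ⁅y, x⁆ y)
    (n : ℕ) : (x * y) ^ n = x ^ n * y ^ n * ⁅y, x⁆ ^ n.choose 2 := by
  induction n with
  | zero => simp
  | succ n ih =>
    have h1 : y ^ n * x = x * (y ^ n * ⁅y, x⁆ ^ n) := by
      have h := commutator_pow_left hy n
      rw [commutatorElement_def, mul_inv_eq_iff_eq_mul, mul_inv_eq_iff_eq_mul] at h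
      rw [h, (hx.pow_left n).eq, mul_assoc, ((hy.pow_left n).pow_right n).eq]
    have h2 : ∀ m, Commute (⁅y, x⁆ ^ m) y := fun m => hy.pow_left m
    have h3 : ∀ m, Commute (⁅y, x⁆ ^ m) x := fun m => hx.pow_left m
    calc (x * y) ^ (n + 1) = x ^ n * y ^ n * (⁅y, x⁆ ^ n.choose 2 * x) * y := by
          rw [pow_succ, ih]; group
      _ = x ^ n * (y ^ n * x) * (⁅y, x⁆ ^ n.choose 2 * y) := by rw [(h3 _).eq]; group
      _ = x ^ n * x * y ^ n * (⁅y, x⁆ ^ n * y) * ⁅y, x⁆ ^ n.choose 2 := by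
          rw [h1, (h2 (n.choose 2)).eq]; group
      _ = x ^ (n + 1) * y ^ (n + 1) * ⁅y, x⁆ ^ (n + 1).choose 2 := by
          rw [(h2 n).eq, Nat.choose_succ_succ' n 1, Nat.choose_one_right, pow_add, pow_succ,
            pow_succ]
          group

lemma mul_pow_prime_of_commute_commutator {p : ℕ} (hp : p.Prime) (hodd : Odd p) {x y : K}
    (hx : Commute ⁅y, x⁆ x) (hy : Commute ⁅y, x⁆ y) (h : ⁅y, x⁆ ^ p = 1) :
    (x * y) ^ p = x ^ p * y ^ p := by
  have h2 : 2 < p := lt_of_le_of_ne hp.two_le fun h => by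
    rw [← h] at hodd; exact absurd hodd (by decide)
  obtain ⟨c, hc⟩ := hp.dvd_choose_self two_ne_zero h2
  rw [mul_pow_of_commute_commutator hx hy, hc, pow_mul, h, one_pow, mul_one]

/-- A descending chain of normal subgroups with `[Wᵢ, Wᵢ] ≤ Wᵢ₊₁` and `Wᵢᵖ ≤ Wᵢ₊₁`, inside a
normal subgroup `P`. -/
structure IsPowerChain (p : ℕ) (P : Subgroup K) (W : ℕ → Subgroup K) : Prop where
  normal : ∀ i, (W i).Normal
  le : ∀ i, W i ≤ P
  commutator_le : ∀ i, ⁅W i, W i⁆ ≤ W (i + 1)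
  pow_mem : ∀ i, ∀ x ∈ W i, x ^ p ∈ W (i + 1)

variable {p : ℕ} {P : Subgroup K} {W : ℕ → Subgroup K}

lemma IsPowerChain.pow_pow_mem (hW : IsPowerChain p P W) {i : ℕ} {x : K} (hx : x ∈ W i) (j : ℕ) :
    x ^ p ^ j ∈ W (i + j) := by
  induction j with
  | zero => simpa using hx
  | succ j ih =>
    rw [pow_succ, pow_mul]
    exact hW.pow_mem _ _ ih

/-- Modulo `[W (i + 1), P]` the commutator `[y, x]` is central in `⟨x, y⟩` and `[y, x] ^ p = [y ^ p,
x]` is trivial, so the class-two power formula applies. -/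
lemma IsPowerChain.pow_mul_mem (hp : p.Prime) (hodd : Odd p) [P.Normal] (hW : IsPowerChain p P W)
    {i : ℕ} {x y : K} (hx : x ∈ W i) (hy : y ∈ W i) :
    (x ^ p * y ^ p)⁻¹ * (x * y) ^ p ∈ ⁅W (i + 1), P⁆ := by
  have := hW.normal (i + 1)
  have hc : ⁅y, x⁆ ∈ W (i + 1) := hW.commutator_le i (Subgroup.commutator_mem_commutator hy hx)
  have hcomm : ∀ z ∈ W i, Commute (⁅(y : K ⧸ ⁅W (i + 1), P⁆), (x : K ⧸ ⁅W (i + 1), P⁆)⁆)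
      (z : K ⧸ ⁅W (i + 1), P⁆) := fun z hz =>
    mk_commute_of_commutator_mem (a := ⁅y, x⁆)
      (Subgroup.commutator_mem_commutator hc (hW.le i hz))
  rw [← QuotientGroup.eq]
  refine (mul_pow_prime_of_commute_commutator hp hodd (hcomm x hx) (hcomm y hy) ?_).symm
  rw [← commutator_pow_left (hcomm y hy)]
  exact mk_eq_one_of_mem (Subgroup.commutator_mem_commutator (hW.pow_mem i y hy) (hW.le i hx))

/-- If the `m`-th power map is multiplicative on `V` modulo `N` and `m`-th powers of elements of
`V` commute with `P` modulo `N`, then `m`-th powers of elements of `[V, P]` lie in `N`. -/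
lemma pow_mem_of_mem_commutator {V N : Subgroup K} [V.Normal] [N.Normal] {m : ℕ}
    (hmul : ∀ x ∈ V, ∀ y ∈ V, (x ^ m * y ^ m)⁻¹ * (x * y) ^ m ∈ N)
    (hcomm : ∀ x ∈ V, ∀ g ∈ P, ⁅x ^ m, g⁆ ∈ N) {z : K} (hz : z ∈ ⁅V, P⁆) : z ^ m ∈ N := by
  have hmul' : ∀ x ∈ V, ∀ y ∈ V, x ^ m * y ^ m ∈ N → (x * y) ^ m ∈ N := fun x hx y hy h => by
    have := mul_mem h (hmul x hx y hy)
    rwa [mul_inv_cancel_left] at this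
  suffices z ∈ V ∧ z ^ m ∈ N from this.2
  induction hz using Subgroup.closure_induction with
  | mem z hz =>
    obtain ⟨u, hu, g, hg, rfl⟩ := hz
    have hu' : g * u⁻¹ * g⁻¹ ∈ V := ‹V.Normal›.conj_mem _ (inv_mem hu) g
    -- Written this way, the generator is a product of two elements of `V`, and multiplicativity
    -- turns its `m`-th power into `[u ^ m, g]` modulo `N`.
    have e : ⁅u, g⁆ = u * (g * u⁻¹ * g⁻¹) := by rw [commutatorElement_def]; group
    rw [e]
    refine ⟨mul_mem hu hu', hmul' _ hu _ hu' ?_⟩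
    rw [conj_pow, inv_pow, show u ^ m * (g * (u ^ m)⁻¹ * g⁻¹) = ⁅u ^ m, g⁆ by
      rw [commutatorElement_def]; group]
    exact hcomm u hu g hg
  | one => exact ⟨one_mem _, by rw [one_pow]; exact one_mem _⟩
  | mul a b _ _ ha hb => exact ⟨mul_mem ha.1 hb.1, hmul' _ ha.1 _ hb.1 (mul_mem ha.2 hb.2)⟩
  | inv a _ ha => exact ⟨inv_mem ha.1, by rw [inv_pow]; exact inv_mem ha.2⟩

/-- Take one `p`-th power, `(xy)ᵖ = xᵖ yᵖ w`, and apply induction one step down the chain. The error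
`w` is a product of commutators with `P`, so `pow_mem_of_mem_commutator` handles its power. -/
lemma IsPowerChain.pow_pow_mul_mem (hp : p.Prime) (hodd : Odd p) [P.Normal]
    (hW : IsPowerChain p P W) (j i : ℕ) {x y : K} (hx : x ∈ W i) (hy : y ∈ W i) :
    (x ^ p ^ j * y ^ p ^ j)⁻¹ * (x * y) ^ p ^ j ∈ ⁅W (i + j), P⁆ := by
  induction j generalizing i x y with
  | zero => simp [one_mem]
  | succ j ih =>
    have hi := hW.normal (i + 1)
    have hij := hW.normal (i + 1 + j)
    rw [show i + (j + 1) = i + 1 + j by ring]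
    have hw := hW.pow_mul_mem hp hodd hx hy
    set w := (x ^ p * y ^ p)⁻¹ * (x * y) ^ p with hwdef
    have hwW : w ∈ W (i + 1) := Subgroup.commutator_le_left _ _ hw
    have hxp := hW.pow_mem i x hx
    have hyp := hW.pow_mem i y hy
    have hwN : w ^ p ^ j ∈ ⁅W (i + 1 + j), P⁆ :=
      pow_mem_of_mem_commutator (fun a ha b hb => ih (i + 1) ha hb)
        (fun a ha g hg => Subgroup.commutator_mem_commutator (hW.pow_pow_mem ha j) hg) hw
    have e : (x * y) ^ p = x ^ p * y ^ p * w := by rw [hwdef, mul_inv_cancel_left]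
    have h1 := ih (i + 1) (mul_mem hxp hyp) hwW
    have h2 := ih (i + 1) hxp hyp
    rw [← QuotientGroup.eq_one_iff] at hwN
    rw [← QuotientGroup.eq] at h1 h2 ⊢
    rw [pow_succ', pow_mul, pow_mul, pow_mul, e, ← h1, QuotientGroup.mk_mul _ _ (w ^ p ^ j), hwN,
      mul_one, ← h2]

/-- Along a chain reaching the centralizer of `P` after `k` steps, `[W₀, P]` has exponent dividing
`pᵏ`. -/
theorem IsPowerChain.pow_eq_one (hp : p.Prime) (hodd : Odd p) [P.Normal]
    (hW : IsPowerChain p P W) {k : ℕ} (hk : ⁅W k, P⁆ = ⊥) {z : K} (hz : z ∈ ⁅W 0, P⁆) :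
    z ^ p ^ k = 1 := by
  have := hW.normal 0
  rw [← Subgroup.mem_bot]
  refine pow_mem_of_mem_commutator (fun x hx y hy => ?_) (fun x hx g hg => ?_) hz
  · simpa [hk] using hW.pow_pow_mul_mem hp hodd k 0 hx hy
  · rw [← hk]
    exact Subgroup.commutator_mem_commutator (by simpa using hW.pow_pow_mem hx k) hg

end PowerChain

/-! ### Powerful subgroups -/

section Powerful

variable {G : Type u} [Group G]

/-- The subgroup generated by the `p`-th powers of the elements of `M`. -/
def Subgroup.powClosure (p : ℕ) (M : Subgroup G) : Subgroup G :=
  Subgroup.closure ((fun x => x ^ p) '' (M : Set G))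

lemma Subgroup.pow_mem_powClosure {p : ℕ} {M : Subgroup G} {x : G} (hx : x ∈ M) :
    x ^ p ∈ M.powClosure p :=
  Subgroup.subset_closure ⟨x, hx, rfl⟩

lemma Subgroup.powClosure_le {p : ℕ} (M : Subgroup G) : M.powClosure p ≤ M := by
  rw [Subgroup.powClosure, Subgroup.closure_le]
  rintro _ ⟨x, hx, rfl⟩
  exact pow_mem hx p

lemma Subgroup.powClosure_normal {p : ℕ} {M : Subgroup G} (hM : M.Normal) :
    (M.powClosure p).Normal := by
  refine ⟨fun x hx g => ?_⟩
  induction hx using Subgroup.closure_induction with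
  | mem x hx =>
    obtain ⟨y, hy, rfl⟩ := hx
    rw [← conj_pow]
    exact Subgroup.pow_mem_powClosure (hM.conj_mem _ hy g)
  | one => simp [one_mem]
  | mul a b _ _ ha hb => rw [conj_mul.symm]; exact mul_mem ha hb
  | inv a _ ha => rw [← conj_inv]; exact inv_mem ha

/-- The iterated power subgroups `N, Nᵖ, (Nᵖ)ᵖ, …`. -/
def Subgroup.powSeries (p : ℕ) (N : Subgroup G) (i : ℕ) : Subgroup G :=
  (Subgroup.powClosure p)^[i] N

lemma Subgroup.powSeries_succ (p : ℕ) (N : Subgroup G) (i : ℕ) :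
    N.powSeries p (i + 1) = (N.powSeries p i).powClosure p :=
  Function.iterate_succ_apply' _ _ _

lemma Subgroup.powSeries_normal {p : ℕ} {N : Subgroup G} (hN : N.Normal) (i : ℕ) :
    (N.powSeries p i).Normal := by
  induction i with
  | zero => exact hN
  | succ i ih => rw [Subgroup.powSeries_succ]; exact Subgroup.powClosure_normal ih

lemma Subgroup.powSeries_le {p : ℕ} (N : Subgroup G) (i : ℕ) : N.powSeries p i ≤ N := by
  induction i with
  | zero => exact le_rfl
  | succ i ih => rw [Subgroup.powSeries_succ]; exact (Subgroup.powClosure_le _).trans ih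

/-- In a nilpotent group, a subgroup `X` contained in `Y [X, P]` with `Y` normal lies in `Y`. -/
lemma le_of_le_sup_commutator [Group.IsNilpotent G] {X Y P : Subgroup G} [Y.Normal]
    (h : X ≤ Y ⊔ ⁅X, P⁆) : X ≤ Y := by
  set π := QuotientGroup.mk' Y with hπ
  -- Modulo `Y` this gives `X ≤ [X, P]`, so `X` sits in every term of the lower central series.
  have h1 : X.map π ≤ ⁅X.map π, P.map π⁆ := by
    have := Subgroup.map_mono (f := π) h
    rwa [Subgroup.map_sup, (Subgroup.map_eq_bot_iff Y).mpr (by rw [hπ, QuotientGroup.ker_mk']),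
      bot_sup_eq, Subgroup.map_commutator] at this
  have h2 : ∀ n, X.map π ≤ (⊤ : Subgroup (G ⧸ Y)).lowerCentralSeries n := by
    intro n
    induction n with
    | zero => exact le_top
    | succ n ih => exact h1.trans (Subgroup.commutator_mono ih le_top)
  obtain ⟨n, hn⟩ := Subgroup.nilpotent_iff_lowerCentralSeries.mp
    (inferInstance : Group.IsNilpotent (G ⧸ Y))
  have h3 := h2 n
  rwa [hn, le_bot_iff, Subgroup.map_eq_bot_iff, hπ, QuotientGroup.ker_mk'] at h3

/-- If `M` is powerfully embedded in `P` then so is `Mᵖ`. -/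
lemma commutator_powClosure_le [Group.IsNilpotent G] {p : ℕ} (hp : p.Prime) (hodd : Odd p)
    {M P : Subgroup G} (hM : M.Normal) [P.Normal] (hMP : M ≤ P) (h : ⁅M, P⁆ ≤ M.powClosure p) :
    ⁅M.powClosure p, P⁆ ≤ (M.powClosure p).powClosure p := by
  have hM1 := Subgroup.powClosure_normal (p := p) hM
  have hM2 := Subgroup.powClosure_normal (p := p) hM1
  set M1 := M.powClosure p with hM1def
  set M2 := M1.powClosure p
  apply le_of_le_sup_commutator (P := P)
  -- Working modulo `[[M1, P], P]` as well makes `[a, [g, a]]` commute with `P`, so that `(g a g⁻¹)ᵖ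
  -- = ([g, a] a)ᵖ = aᵖ`.
  set N := M2 ⊔ ⁅⁅M1, P⁆, P⁆ with hN
  rw [Subgroup.commutator_le]
  intro z hz g hg
  induction hz using Subgroup.closure_induction with
  | mem z hz =>
    obtain ⟨a, ha, rfl⟩ := hz
    have hc : ⁅g, a⁆ ∈ M1 := by
      apply h
      rw [Subgroup.commutator_comm]
      exact Subgroup.commutator_mem_commutator hg ha
    have hcP : ⁅g, a⁆ ∈ P := (Subgroup.powClosure_le M).trans hMP hc
    have hd : ⁅a, ⁅g, a⁆⁆ ∈ ⁅M1, P⁆ := by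
      rw [Subgroup.commutator_comm]
      exact Subgroup.commutator_mem_commutator (hMP ha) hc
    have hcomm : ∀ z ∈ P, Commute (⁅(a : G ⧸ N), ((⁅g, a⁆ : G) : G ⧸ N)⁆) (z : G ⧸ N) :=
      fun z hz => mk_commute_of_commutator_mem (a := ⁅a, ⁅g, a⁆⁆)
        (Subgroup.mem_sup_right (Subgroup.commutator_mem_commutator hd hz))
    have h2 : ∀ z ∈ M1, (z : G ⧸ N) ^ p = 1 := fun z hz => by
      rw [← QuotientGroup.mk_pow]
      exact mk_eq_one_of_mem (Subgroup.mem_sup_left (Subgroup.pow_mem_powClosure hz))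
    have hpow := mul_pow_prime_of_commute_commutator hp hodd (hcomm _ hcP) (hcomm a (hMP ha))
      (h2 ⁅a, ⁅g, a⁆⁆ (Subgroup.commutator_le_left _ _ hd))
    rw [h2 _ hc, one_mul] at hpow
    have e : ((⁅g, a⁆ : G) : G ⧸ N) * a = g * a * (g : G ⧸ N)⁻¹ := by
      rw [← QuotientGroup.mk_inv, ← QuotientGroup.mk_mul, ← QuotientGroup.mk_mul,
        ← QuotientGroup.mk_mul, commutatorElement_def, inv_mul_cancel_right]
    rw [e, conj_pow, mul_inv_eq_iff_eq_mul] at hpow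
    rw [← QuotientGroup.eq_one_iff]
    exact Commute.commutator_eq (g₁ := (a : G ⧸ N) ^ p) (g₂ := (g : G ⧸ N)) hpow.symm
  | one => simp [one_mem]
  | mul a b _ _ ha hb =>
    rw [commutatorElement_mul_left_eq_conj_mul]
    exact mul_mem ((inferInstance : N.Normal).conj_mem _ hb _) ha
  | inv a _ ha =>
    rw [commutatorElement_inv_left, ← commutatorElement_inv]
    simpa using (inferInstance : N.Normal).conj_mem _ (inv_mem ha) a⁻¹

/-- The power series of a powerful subgroup is a central-type series of it. -/
lemma commutator_powSeries_le [Group.IsNilpotent G] {p : ℕ} (hp : p.Prime) (hodd : Odd p)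
    {N : Subgroup G} [N.Normal] (h : ⁅N, N⁆ ≤ N.powClosure p) (i : ℕ) :
    ⁅N.powSeries p i, N⁆ ≤ N.powSeries p (i + 1) := by
  induction i with
  | zero => exact h
  | succ i ih =>
    rw [Subgroup.powSeries_succ] at ih
    rw [Subgroup.powSeries_succ _ _ (i + 1), Subgroup.powSeries_succ]
    exact commutator_powClosure_le hp hodd (Subgroup.powSeries_normal inferInstance i)
      (Subgroup.powSeries_le N i) ih

lemma isPowerChain_powSeries [Group.IsNilpotent G] {p : ℕ} (hp : p.Prime) (hodd : Odd p)
    {N : Subgroup G} [N.Normal] (h : ⁅N, N⁆ ≤ N.powClosure p) :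
    IsPowerChain p N (N.powSeries p) where
  normal i := Subgroup.powSeries_normal inferInstance i
  le i := Subgroup.powSeries_le N i
  commutator_le i := (Subgroup.commutator_mono le_rfl (Subgroup.powSeries_le N i)).trans
    (commutator_powSeries_le hp hodd h i)
  pow_mem i x hx := by
    rw [Subgroup.powSeries_succ]; exact Subgroup.pow_mem_powClosure hx

/-- A finite `p`-group generated by its `p`-th powers is trivial. -/
lemma eq_bot_of_le_powClosure [Finite G] {p : ℕ} (hp : p.Prime) (hG : IsPGroup p G)
    {M : Subgroup G} (h : M ≤ M.powClosure p) : M = ⊥ := by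
  have := Fact.mk hp
  have hMp : IsPGroup p M := hG.to_subgroup M
  have : Group.IsNilpotent M := hMp.isNilpotent
  by_contra hne
  have : Nontrivial M := (Subgroup.nontrivial_iff_ne_bot M).mpr hne
  -- A nontrivial `M` has nontrivial abelianization. There `p`-th powers would be surjective, hence
  -- so would `|M|`-th powers, which are trivial.
  have hlt := Group.IsSolvable.commutator_lt_top_of_nontrivial M
  refine hlt.ne (top_le_iff.mp fun x _ => ?_)
  rw [← Abelianization.ker_of M, MonoidHom.mem_ker]
  have hsurj : Function.Surjective fun a : Abelianization M => a ^ p := by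
    have hle : ∀ y : G, ∀ hy : y ∈ M,
        Abelianization.of (⟨y, hy⟩ : M) ∈ (powMonoidHom p : Abelianization M →* _).range := by
      intro y hy
      have hy' := h hy
      induction hy' using Subgroup.closure_induction with
      | mem z hz =>
        obtain ⟨w, hw, rfl⟩ := hz
        exact ⟨Abelianization.of ⟨w, hw⟩, by rw [powMonoidHom_apply, ← map_pow]; rfl⟩
      | one => exact one_mem _
      | mul a b ha hb iha ihb =>
        have ha' := Subgroup.powClosure_le M ha
        have hb' := Subgroup.powClosure_le M hb
        exact mul_mem (iha ha') (ihb hb')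
      | inv a ha iha => exact inv_mem (iha (Subgroup.powClosure_le M ha))
    intro a
    obtain ⟨⟨y, hy⟩, rfl⟩ := QuotientGroup.mk_surjective a
    exact hle y hy
  obtain ⟨r, hr⟩ := hMp.exists_card_eq
  have hsurj' : ∀ j, Function.Surjective fun a : Abelianization M => a ^ p ^ j := by
    intro j
    induction j with
    | zero => intro a; exact ⟨a, by simp⟩
    | succ j ih =>
      intro a
      obtain ⟨b, rfl⟩ := ih a
      obtain ⟨c, rfl⟩ := hsurj b
      exact ⟨c, by simp only [pow_succ', pow_mul]⟩
  obtain ⟨b, hb⟩ := hsurj' r (Abelianization.of x)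
  obtain ⟨y, rfl⟩ := QuotientGroup.mk_surjective b
  have hy : (Abelianization.of y) ^ p ^ r = 1 := by rw [← map_pow, ← hr, pow_card_eq_one', map_one]
  exact hb.symm.trans hy

/-- In a powerful subgroup of exponent dividing `pᵏ` the power series vanishes after `k` steps. -/
lemma powSeries_eq_bot [Finite G] {p : ℕ} (hp : p.Prime) (hodd : Odd p) (hG : IsPGroup p G)
    {N : Subgroup G} [N.Normal] (h : ⁅N, N⁆ ≤ N.powClosure p) {k : ℕ}
    (hk : ∀ x ∈ N, x ^ p ^ k = 1) : N.powSeries p k = ⊥ := by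
  have := Fact.mk hp
  have : Group.IsNilpotent G := hG.isNilpotent
  have hW := isPowerChain_powSeries hp hodd h
  -- The case `m = 0` says that the `k`-th term lies in its own power subgroup, hence is trivial. On
  -- products the error lies in `[N.powSeries p k, N]`, which powerfulness puts in the next term.
  have key : ∀ j m, j + m = k → ∀ x ∈ N.powSeries p j, x ^ p ^ m ∈ N.powSeries p (k + 1) := by
    intro j
    induction j with
    | zero =>
      rintro m hm x hx
      rw [show m = k by omega, hk x hx]
      exact one_mem _
    | succ j ih =>
      intro m hm x hx
      suffices x ∈ N.powSeries p (j + 1) ∧ x ^ p ^ m ∈ N.powSeries p (k + 1) from this.2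
      rw [Subgroup.powSeries_succ] at hx
      induction hx using Subgroup.closure_induction with
      | mem z hz =>
        obtain ⟨y, hy, rfl⟩ := hz
        refine ⟨hW.pow_mem j y hy, ?_⟩
        have := ih (m + 1) (by omega) y hy
        rwa [pow_succ', pow_mul] at this
      | one => exact ⟨one_mem _, by rw [one_pow]; exact one_mem _⟩
      | mul a b _ _ ha hb =>
        refine ⟨mul_mem ha.1 hb.1, ?_⟩
        have h1 := hW.pow_pow_mul_mem hp hodd m (j + 1) ha.1 hb.1
        rw [hm] at h1
        have := mul_mem (mul_mem ha.2 hb.2) (commutator_powSeries_le hp hodd h k h1)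
        rwa [mul_inv_cancel_left] at this
      | inv a _ ha => exact ⟨inv_mem ha.1, by rw [inv_pow]; exact inv_mem ha.2⟩
  refine eq_bot_of_le_powClosure hp hG fun x hx => ?_
  rw [← Subgroup.powSeries_succ]
  simpa using key k 0 rfl x hx

end Powerful

/-! ### Commutator subgroups of central extensions -/

section CentralExtension

variable {G K : Type u} [Group G] [Group K]

/-- The commutator subgroup of a central extension of `G` has exponent dividing `exp G`. -/
theorem pow_eq_one_of_mem_commutator_of_central [Finite G] {p n : ℕ} (hp : p.Prime)
    (hodd : Odd p) (hG : IsPGroup p G) (hexp : ∀ g : G, g ^ p ^ n = 1)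
    (hpowerful : ⁅powerSubgroup G p, powerSubgroup G p⁆ ≤ (powerSubgroup G p).powClosure p)
    (hexp_pow : ∀ g ∈ powerSubgroup G p, g ^ p ^ (n - 1) = 1)
    (hlow : (⊤ : Subgroup G).lowerCentralSeries p ≤ powerSubgroup G p)
    (q : K →* G) (hker : q.ker ≤ Subgroup.center K) {z : K}
    (hz : z ∈ commutator K) : z ^ p ^ n = 1 := by
  have := Fact.mk hp
  have : Group.IsNilpotent G := hG.isNilpotent
  rcases n with _ | n
  -- Truncated `n - 1` makes `n = 0` a separate case: `G` is trivial and `K` is abelian.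
  · have hc : (⊤ : Subgroup K) ≤ Subgroup.center K := fun x _ =>
      hker (by rw [MonoidHom.mem_ker]; simpa using hexp (q x))
    rw [commutator_def, Subgroup.commutator_top_right_eq_bot_iff_le_center.mpr hc,
      Subgroup.mem_bot] at hz
    rw [hz, one_pow]
  set N := powerSubgroup G p with hN
  have hpowN : ∀ g : G, g ^ p ∈ N := fun g => Subgroup.subset_closure ⟨g, rfl⟩
  have hNn : N.Normal := by
    have : N = (⊤ : Subgroup G).powClosure p := by
      simp [hN, powerSubgroup, Subgroup.powClosure]
    rw [this]
    exact Subgroup.powClosure_normal inferInstance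
  have hchain := isPowerChain_powSeries hp hodd hpowerful
  have hbot := powSeries_eq_bot hp hodd hG hpowerful hexp_pow
  rw [Nat.add_sub_cancel] at hbot
  set W : ℕ → Subgroup K := fun i => (N.powSeries p i).comap q with hW
  have hWchain : IsPowerChain p ⊤ W :=
    { normal := fun i => (hchain.normal i).comap q
      le := fun _ => le_top
      commutator_le := fun i => by
        rw [Subgroup.commutator_le]
        intro x hx y hy
        rw [hW, Subgroup.mem_comap, map_commutatorElement]
        exact hchain.commutator_le i (Subgroup.commutator_mem_commutator hx hy)
      pow_mem := fun i x hx => by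
        rw [hW, Subgroup.mem_comap, map_pow]
        exact hchain.pow_mem i _ hx }
  have hWn : (W 0).Normal := hWchain.normal 0
  have hcen : ⁅W n, (⊤ : Subgroup K)⁆ = ⊥ := by
    rw [Subgroup.commutator_top_right_eq_bot_iff_le_center]
    refine le_trans (fun x hx => ?_) hker
    have : q x ∈ N.powSeries p n := hx
    rwa [hbot, Subgroup.mem_bot] at this
  -- The exponent splits as `p · p ^ n`: one factor `p` for `[K, K]` modulo `Z`, the rest for `Z`.
  set Z := ⁅W 0, (⊤ : Subgroup K)⁆ with hZ
  have hcenter : ∀ x ∈ W 0, (x : K ⧸ Z) ∈ Subgroup.center (K ⧸ Z) := by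
    intro x hx
    rw [Subgroup.mem_center_iff]
    intro g
    obtain ⟨g, rfl⟩ := QuotientGroup.mk_surjective g
    exact (mk_commute_of_commutator_mem
      (Subgroup.commutator_mem_commutator hx (Subgroup.mem_top g))).symm.eq
  have hz1 : ((z : K ⧸ Z)) ^ p = 1 := by
    have htop : (⊤ : Subgroup K).map (QuotientGroup.mk' Z) = ⊤ :=
      Subgroup.map_top_of_surjective _ (QuotientGroup.mk'_surjective _)
    apply pow_prime_eq_one_of_mem_commutator hp
    · intro x
      obtain ⟨x, rfl⟩ := QuotientGroup.mk_surjective x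
      refine hcenter (x ^ p) ?_
      change q (x ^ p) ∈ N
      rw [map_pow]
      exact hpowN _
    · rw [← htop, ← Subgroup.map_lowerCentralSeries, Subgroup.map_le_iff_le_comap]
      intro x hx
      refine hcenter x (hlow ?_)
      have := Subgroup.mem_map_of_mem q hx
      rw [Subgroup.map_lowerCentralSeries] at this
      exact Subgroup.lowerCentralSeries_mono p le_top this
    · rw [commutator_def, ← htop, ← Subgroup.map_commutator]
      exact Subgroup.mem_map_of_mem (QuotientGroup.mk' Z) hz
  rw [pow_succ', pow_mul]
  exact hWchain.pow_eq_one hp hodd hcen ((QuotientGroup.eq_one_iff _).mp hz1)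

end CentralExtension

/-! ### Calculus in the nonabelian exterior square -/

namespace ExteriorSquare

variable {G : Type u} [Group G]

/-- The generator `g ∧ h`. -/
def wedge (g h : G) : ExteriorSquare G := PresentedGroup.of (g, h)

lemma wedge_mul_left (g g' h : G) :
    wedge (g * g') h = wedge (g * g' * g⁻¹) (g * h * g⁻¹) * wedge g h :=
  mul_inv_eq_one.mp (PresentedGroup.one_of_mem (ExteriorSquareRel.mul_left g g' h))

lemma wedge_mul_right (g h h' : G) :
    wedge g (h * h') = wedge g h * wedge (h * g * h⁻¹) (h * h' * h⁻¹) :=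
  mul_inv_eq_one.mp (PresentedGroup.one_of_mem (ExteriorSquareRel.mul_right g h h'))

@[simp] lemma wedge_self (g : G) : wedge g g = 1 :=
  PresentedGroup.one_of_mem (ExteriorSquareRel.diag g)

@[simp] lemma wedge_one_left (h : G) : wedge 1 h = 1 := by
  simpa using wedge_mul_left 1 1 h

@[simp] lemma wedge_one_right (g : G) : wedge g 1 = 1 := by
  simpa using wedge_mul_right g 1 1

/-- Expand `hg ∧ hg = 1` with `hg = g (g⁻¹hg)`. -/
lemma wedge_swap (g h : G) : wedge h g * wedge g h = 1 := by
  have key : wedge (g * (g⁻¹ * h * g)) (g * (g⁻¹ * h * g)) = 1 := wedge_self _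
  rw [wedge_mul_left g (g⁻¹ * h * g), wedge_mul_right g g] at key
  have e1 : g * (g⁻¹ * h * g) * g⁻¹ = h := by group
  have e2 : g * (g * (g⁻¹ * h * g)) * g⁻¹ = g * h := by group
  rw [e1, e2, wedge_mul_right h g h] at key
  simpa using key

/-- A homomorphism out of the exterior square is determined by a pairing. -/
def lift {H : Type u} [Group H] (f : G → G → H)
    (hl : ∀ g g' h, f (g * g') h = f (g * g' * g⁻¹) (g * h * g⁻¹) * f g h)
    (hr : ∀ g h h', f g (h * h') = f g h * f (h * g * h⁻¹) (h * h' * h⁻¹))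
    (hd : ∀ g, f g g = 1) : ExteriorSquare G →* H :=
  PresentedGroup.toGroup (f := fun x : G × G => f x.1 x.2) (by
    rintro _ (⟨g, g', h⟩ | ⟨g, h, h'⟩ | g)
    · simp only [map_mul, map_inv, FreeGroup.lift_apply_of, mul_inv_eq_one]; exact hl g g' h
    · simp only [map_mul, map_inv, FreeGroup.lift_apply_of, mul_inv_eq_one]; exact hr g h h'
    · simpa using hd g)

@[simp] lemma lift_wedge {H : Type u} [Group H] (f : G → G → H) (hl hr hd) (g h : G) :
    lift f hl hr hd (wedge g h) = f g h :=
  PresentedGroup.toGroup.of _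

lemma hom_ext {H : Type u} [Group H] {φ ψ : ExteriorSquare G →* H}
    (h : ∀ g h, φ (wedge g h) = ψ (wedge g h)) : φ = ψ :=
  PresentedGroup.ext fun x => h x.1 x.2

lemma closure_wedge :
    Subgroup.closure {e : ExteriorSquare G | ∃ g h, wedge g h = e} = ⊤ := by
  rw [← PresentedGroup.closure_range_of]
  congr 1
  ext e
  exact ⟨fun ⟨g, h, he⟩ => ⟨(g, h), he⟩, fun ⟨x, hx⟩ => ⟨x.1, x.2, hx⟩⟩

/-- The commutator map `g ∧ h ↦ [g, h]`. -/
def toCommutator : ExteriorSquare G →* G :=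
  lift (fun g h => ⁅g, h⁆) (by intros; simp only [commutatorElement_def]; group)
    (by intros; simp only [commutatorElement_def]; group) (by simp)

@[simp] lemma toCommutator_wedge (g h : G) : toCommutator (wedge g h) = ⁅g, h⁆ :=
  lift_wedge _ _ _ _ _ _

/-- The action of `G` on `G ∧ G` by conjugation. -/
def act (x : G) : ExteriorSquare G →* ExteriorSquare G :=
  lift (fun g h => wedge (x * g * x⁻¹) (x * h * x⁻¹))
    (fun g g' h => by
      have := wedge_mul_left (x * g * x⁻¹) (x * g' * x⁻¹) (x * h * x⁻¹)
      convert this using 2 <;> group)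
    (fun g h h' => by
      have := wedge_mul_right (x * g * x⁻¹) (x * h * x⁻¹) (x * h' * x⁻¹)
      convert this using 2 <;> group)
    (fun g => wedge_self _)

@[simp] lemma act_wedge (x g h : G) : act x (wedge g h) = wedge (x * g * x⁻¹) (x * h * x⁻¹) :=
  lift_wedge _ _ _ _ _ _

lemma act_mul (x y : G) (e : ExteriorSquare G) : act (x * y) e = act x (act y e) := by
  have : act (x * y) = (act x).comp (act y) := hom_ext fun g h => by
    simp only [act_wedge, MonoidHom.comp_apply]; congr 1 <;> group
  rw [this, MonoidHom.comp_apply]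

lemma act_one (e : ExteriorSquare G) : act 1 e = e := by
  have : act (1 : G) = MonoidHom.id _ := hom_ext fun g h => by simp
  rw [this, MonoidHom.id_apply]

lemma wedge_mul_left' (g g' h : G) : wedge (g * g') h = act g (wedge g' h) * wedge g h := by
  rw [act_wedge, wedge_mul_left]

lemma wedge_mul_right' (g h h' : G) : wedge g (h * h') = wedge g h * act h (wedge g h') := by
  rw [act_wedge, wedge_mul_right]

/-- Conjugation by `g ∧ h` is the action of `[g, h]`. -/
lemma wedge_conj (g h : G) (e : ExteriorSquare G) :
    wedge g h * e * (wedge g h)⁻¹ = act ⁅g, h⁆ e := by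
  -- Compare the two expansions of `ga ∧ hb`, by the left argument first and by the right one first.
  have key : ∀ a b, wedge g h * act (h * g) (wedge a b) =
      act (g * h) (wedge a b) * wedge g h := by
    intro a b
    have h1 : wedge (g * a) (h * b) = act g (wedge a h) * wedge g h *
        (act (h * g) (wedge a b) * act h (wedge g b)) := by
      rw [wedge_mul_right', wedge_mul_left', wedge_mul_left' g a b, map_mul, act_mul]
    have h2 : wedge (g * a) (h * b) = act g (wedge a h) * act (g * h) (wedge a b) *
        (wedge g h * act h (wedge g b)) := by
      rw [wedge_mul_left', wedge_mul_right', wedge_mul_right' g h b, map_mul, act_mul]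
    have h3 := h1.symm.trans h2
    simp only [mul_assoc, mul_left_cancel_iff] at h3
    simpa only [← mul_assoc, mul_right_cancel_iff] using h3
  have heq : (MulAut.conj (wedge g h)).toMonoidHom = act ⁅g, h⁆ := hom_ext fun a b => by
    have h1 := key ((h * g)⁻¹ * a * (h * g)) ((h * g)⁻¹ * b * (h * g))
    have h2 : wedge ((h * g)⁻¹ * a * (h * g)) ((h * g)⁻¹ * b * (h * g)) =
        act (h * g)⁻¹ (wedge a b) := by simp
    rw [h2, ← act_mul, ← act_mul, mul_inv_cancel, act_one] at h1
    change wedge g h * wedge a b * (wedge g h)⁻¹ = _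
    rw [h1, mul_inv_cancel_right, commutatorElement_def]
    congr 2
    group
  exact DFunLike.congr_fun heq e

lemma conj_eq_act (e e' : ExteriorSquare G) : e * e' * e⁻¹ = act (toCommutator e) e' := by
  have he : e ∈ Subgroup.closure {e : ExteriorSquare G | ∃ g h, wedge g h = e} := by
    rw [closure_wedge]; trivial
  induction he using Subgroup.closure_induction generalizing e' with
  | mem e he =>
    obtain ⟨g, h, rfl⟩ := he
    rw [wedge_conj, toCommutator_wedge]
  | one => simp [act_one]
  | mul a b _ _ ha hb =>
    rw [map_mul, act_mul, ← ha, ← hb]; group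
  | inv a _ ha =>
    have h := ha (act (toCommutator a⁻¹) e')
    rw [← act_mul, ← map_mul, mul_inv_cancel, map_one, act_one] at h
    generalize act (toCommutator a⁻¹) e' = w at h ⊢
    rw [← h]; group

lemma wedge_commutator (x g h : G) : wedge x ⁅g, h⁆ = act x (wedge g h) * (wedge g h)⁻¹ := by
  have h1 : wedge x ⁅g, h⁆ = wedge x (g * h * g⁻¹) *
      act (g * h * g⁻¹) (wedge x h⁻¹) := by
    rw [← wedge_mul_right', commutatorElement_def]
  have h2 : act h (wedge x h⁻¹) = (wedge x h)⁻¹ := by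
    have := wedge_mul_right' x h h⁻¹
    rw [mul_inv_cancel, wedge_one_right] at this
    exact (inv_eq_of_mul_eq_one_right this.symm).symm
  have h3 : act (g * h * g⁻¹) (wedge x h⁻¹) = wedge g h * (wedge x h)⁻¹ * (wedge g h)⁻¹ := by
    rw [wedge_conj, ← h2, ← act_mul, commutatorElement_def, inv_mul_cancel_right]
  have h4 : wedge x (g * h * g⁻¹) * wedge g h = act x (wedge g h) * wedge x h := by
    rw [← wedge_mul_left', show x * g = g * (g⁻¹ * x * g) by group, wedge_mul_left']
    simp only [act_wedge]
    congr 2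
    group
  rw [h1, h3, ← mul_assoc, ← mul_assoc, h4, mul_inv_cancel_right]

lemma wedge_toCommutator (x : G) (e : ExteriorSquare G) :
    wedge x (toCommutator e) = act x e * e⁻¹ := by
  have he : e ∈ Subgroup.closure {e : ExteriorSquare G | ∃ g h, wedge g h = e} := by
    rw [closure_wedge]; trivial
  induction he using Subgroup.closure_induction with
  | mem e he =>
    obtain ⟨g, h, rfl⟩ := he
    rw [toCommutator_wedge, wedge_commutator]
  | one => simp
  | mul a b _ _ ha hb =>
    rw [map_mul, wedge_mul_right', ← conj_eq_act, ha, hb, map_mul]; group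
  | inv a _ ha =>
    have h := wedge_mul_right' x (toCommutator a) (toCommutator a⁻¹)
    rw [← map_mul, mul_inv_cancel, map_one, wedge_one_right, ← conj_eq_act, ha] at h
    generalize wedge x (toCommutator a⁻¹) = w at h ⊢
    have h' : act x a * (w * a⁻¹) = 1 := by rw [h]; group
    rw [map_inv, inv_eq_of_mul_eq_one_right h', inv_inv, inv_mul_cancel_right]

lemma commutator_eq_wedge (e e' : ExteriorSquare G) :
    ⁅e, e'⁆ = wedge (toCommutator e) (toCommutator e') := by
  rw [commutatorElement_def, conj_eq_act, wedge_toCommutator]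

/-- Needed when a lift of `x` is adjoined: powers of that lift commute, so their wedges must vanish.
-/
lemma wedge_zpow_zpow (x : G) (a b : ℤ) : wedge (x ^ a) (x ^ b) = 1 := by
  have hc : ∀ a b : ℤ, x ^ a * x ^ b * (x ^ a)⁻¹ = x ^ b := fun a b => by
    rw [(Commute.zpow_zpow_self x a b).eq, mul_inv_cancel_right]
  let f : ℤ → Multiplicative ℤ →* ExteriorSquare G := fun a =>
    { toFun := fun b => wedge (x ^ a) (x ^ b.toAdd)
      map_one' := by simp
      map_mul' := fun b c => by
        rw [toAdd_mul, zpow_add, wedge_mul_right, hc, hc] }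
  have hf : ∀ a : ℤ, wedge (x ^ a) x = 1 → ∀ b : ℤ, wedge (x ^ a) (x ^ b) = 1 := by
    intro a ha b
    have : f a = 1 := MonoidHom.ext_mint (by simpa [f] using ha)
    exact DFunLike.congr_fun this (Multiplicative.ofAdd b)
  have h1 : ∀ a : ℤ, wedge (x ^ a) x = 1 := by
    intro a
    have h := hf 1 (by simp) a
    rw [zpow_one] at h
    simpa [h] using wedge_swap x (x ^ a)
  exact hf a (h1 a) b

end ExteriorSquare

/-! ### A central extension containing the exterior square -/

namespace ExteriorSquare

variable {G : Type u} [Group G]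

/-- A group `H` over `G` that contains `G ∧ G` and whose commutators are given by the wedge. -/
structure CommutatorModel (G : Type u) [Group G] (H : Type u) [Group H] where
  /-- The embedding of the exterior square. -/
  incl : ExteriorSquare G →* H
  /-- The projection to `G`. -/
  proj : H →* G
  incl_injective : Function.Injective incl
  proj_incl : ∀ e, proj (incl e) = toCommutator e
  conj_incl : ∀ u e, u * incl e * u⁻¹ = incl (act (proj u) e)
  commutator_eq : ∀ u v, ⁅u, v⁆ = incl (wedge (proj u) (proj v))

/-- The exterior square itself, over the commutator subgroup. -/
def CommutatorModel.base (G : Type u) [Group G] : CommutatorModel G (ExteriorSquare G) where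
  incl := MonoidHom.id _
  proj := toCommutator
  incl_injective := Function.injective_id
  proj_incl _ := rfl
  conj_incl := conj_eq_act
  commutator_eq := commutator_eq_wedge

namespace CommutatorModel

variable {H : Type u} [Group H] (D : CommutatorModel G H)

/-- The endomorphism `h ↦ (x ∧ h) h`, conjugation by a virtual lift of `x`. -/
def twistEnd (x : G) : H →* H where
  toFun h := D.incl (wedge x (D.proj h)) * h
  map_one' := by simp
  map_mul' h h' := by
    rw [map_mul, wedge_mul_right', map_mul, ← D.conj_incl]; group

lemma twistEnd_apply (x : G) (h : H) : D.twistEnd x h = D.incl (wedge x (D.proj h)) * h := rfl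

lemma proj_twistEnd (x : G) (h : H) : D.proj (D.twistEnd x h) = x * D.proj h * x⁻¹ := by
  rw [twistEnd_apply, map_mul, D.proj_incl, toCommutator_wedge, commutatorElement_def,
    inv_mul_cancel_right]

lemma twistEnd_mul (x y : G) (h : H) : D.twistEnd (x * y) h = D.twistEnd x (D.twistEnd y h) := by
  rw [D.twistEnd_apply x, proj_twistEnd, twistEnd_apply, twistEnd_apply, ← mul_assoc, ← map_mul]
  congr 2
  rw [show x * y = y * (y⁻¹ * x * y) by group, wedge_mul_left']
  simp only [act_wedge]
  congr 2
  group

lemma twistEnd_one (h : H) : D.twistEnd 1 h = h := by simp [twistEnd_apply]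

/-- The action of `G` on `H` by twisting. -/
def twist : G →* MulAut H where
  toFun x :=
    { toFun := D.twistEnd x
      invFun := D.twistEnd x⁻¹
      left_inv := fun h => by rw [← twistEnd_mul, inv_mul_cancel, twistEnd_one]
      right_inv := fun h => by rw [← twistEnd_mul, mul_inv_cancel, twistEnd_one]
      map_mul' := map_mul _ }
  map_one' := MulEquiv.ext fun h => D.twistEnd_one h
  map_mul' x y := MulEquiv.ext fun h => D.twistEnd_mul x y h

/-- The action of the infinite cyclic group by twisting with powers of `x`. -/
def zpowersTwist (x : G) : Multiplicative ℤ →* MulAut H := D.twist.comp (zpowersHom G x)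

/-- The projection of the model extended by a lift of `x`. -/
def adjoinProj (x : G) : H ⋊[D.zpowersTwist x] Multiplicative ℤ →* G :=
  SemidirectProduct.lift D.proj (zpowersHom G x) fun _ =>
    MonoidHom.ext fun h => D.proj_twistEnd _ h

@[simp] lemma adjoinProj_inl (x : G) (h : H) :
    D.adjoinProj x (SemidirectProduct.inl h) = D.proj h :=
  SemidirectProduct.lift_inl ..

@[simp] lemma adjoinProj_inr (x : G) (a : Multiplicative ℤ) :
    D.adjoinProj x (SemidirectProduct.inr a) = zpowersHom G x a :=
  SemidirectProduct.lift_inr ..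

lemma adjoin_conj_incl (x : G) (u : H ⋊[D.zpowersTwist x] Multiplicative ℤ) (e) :
    u * SemidirectProduct.inl (D.incl e) * u⁻¹ =
      SemidirectProduct.inl (D.incl (act (D.adjoinProj x u) e)) := by
  have hr : ∀ a : Multiplicative ℤ, ∀ e,
      (SemidirectProduct.inr a * SemidirectProduct.inl (D.incl e) * (SemidirectProduct.inr a)⁻¹ :
        H ⋊[D.zpowersTwist x] Multiplicative ℤ) =
      SemidirectProduct.inl (D.incl (act (zpowersHom G x a) e)) := by
    intro a e
    rw [← map_inv, ← SemidirectProduct.inl_aut]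
    congr 1
    change D.incl (wedge (zpowersHom G x a) (D.proj (D.incl e))) * D.incl e = _
    rw [D.proj_incl, wedge_toCommutator, ← map_mul, inv_mul_cancel_right]
  rw [← SemidirectProduct.inl_left_mul_inr_right u, map_mul, adjoinProj_inl, adjoinProj_inr,
    act_mul, ← D.conj_incl, map_mul, map_mul, ← hr, map_inv]
  group

/-- Commutator and wedge obey the same product and swap rules, so it suffices to compare them on the
two factors of the semidirect product. -/
lemma adjoin_commutator_eq (x : G) (u v : H ⋊[D.zpowersTwist x] Multiplicative ℤ) :
    ⁅u, v⁆ = SemidirectProduct.inl (D.incl (wedge (D.adjoinProj x u) (D.adjoinProj x v))) := by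
  let C : H ⋊[D.zpowersTwist x] Multiplicative ℤ → H ⋊[D.zpowersTwist x] Multiplicative ℤ → Prop :=
    fun u v => ⁅u, v⁆ =
      SemidirectProduct.inl (D.incl (wedge (D.adjoinProj x u) (D.adjoinProj x v)))
  have hmul_left : ∀ u u' v, C u v → C u' v → C (u * u') v := by
    intro u u' v h h'
    simp only [C] at h h' ⊢
    rw [commutatorElement_mul_left_eq_conj_mul, h, h', adjoin_conj_incl, ← map_mul, ← map_mul,
      map_mul (D.adjoinProj x), wedge_mul_left']
  have hswap : ∀ u v, C u v → C v u := by
    intro u v h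
    simp only [C] at h ⊢
    rw [← commutatorElement_inv, h, ← map_inv, ← map_inv]
    congr 2
    exact inv_eq_of_mul_eq_one_left (wedge_swap _ _)
  have hrl : ∀ a h, C (SemidirectProduct.inr a) (SemidirectProduct.inl h) := by
    intro a h
    simp only [C]
    rw [commutatorElement_def, ← map_inv, ← SemidirectProduct.inl_aut,
      ← map_inv SemidirectProduct.inl h, ← map_mul, adjoinProj_inl, adjoinProj_inr]
    congr 1
    change D.incl (wedge (zpowersHom G x a) (D.proj h)) * h * h⁻¹ = _
    rw [mul_inv_cancel_right]
  have hll : ∀ h h', C (SemidirectProduct.inl h) (SemidirectProduct.inl h') := by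
    intro h h'
    simp only [C]
    rw [← map_commutatorElement, D.commutator_eq, adjoinProj_inl, adjoinProj_inl]
  have hrr : ∀ a b, C (SemidirectProduct.inr a) (SemidirectProduct.inr b) := by
    intro a b
    simp only [C]
    rw [← map_commutatorElement, (Commute.all a b).commutator_eq, adjoinProj_inr, adjoinProj_inr,
      zpowersHom_apply, zpowersHom_apply, wedge_zpow_zpow]
    simp
  change C u v
  rw [← SemidirectProduct.inl_left_mul_inr_right u, ← SemidirectProduct.inl_left_mul_inr_right v]
  exact hmul_left _ _ _ (hswap _ _ (hmul_left _ _ _ (hll _ _) (hrl _ _)))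
    (hswap _ _ (hmul_left _ _ _ (hswap _ _ (hrl _ _)) (hrr _ _)))

/-- The model extended by a lift of `x`. -/
def adjoin (x : G) : CommutatorModel G (H ⋊[D.zpowersTwist x] Multiplicative ℤ) where
  incl := SemidirectProduct.inl.comp D.incl
  proj := D.adjoinProj x
  incl_injective := SemidirectProduct.inl_injective.comp D.incl_injective
  proj_incl e := by simp [D.proj_incl]
  conj_incl := D.adjoin_conj_incl x
  commutator_eq := D.adjoin_commutator_eq x

/-- Starting from the exterior square, lifts of the finitely many elements of `G` are adjoined one
at a time. -/
lemma exists_surjective [Finite G] :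
    ∃ (H : Type u) (_ : Group H) (D : CommutatorModel G H), Function.Surjective D.proj := by
  have key : ∀ l : List G, ∃ (H : Type u) (_ : Group H) (D : CommutatorModel G H),
      ∀ x ∈ l, x ∈ D.proj.range := by
    intro l
    induction l with
    | nil => exact ⟨_, _, CommutatorModel.base G, by simp⟩
    | cons x l ih =>
      obtain ⟨H, _, D, hD⟩ := ih
      refine ⟨_, _, D.adjoin x, fun y hy => ?_⟩
      rcases List.mem_cons.mp hy with rfl | hy
      · refine ⟨SemidirectProduct.inr (Multiplicative.ofAdd 1), ?_⟩
        exact (D.adjoinProj_inr y _).trans (by simp)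
      · obtain ⟨h, rfl⟩ := hD y hy
        exact ⟨SemidirectProduct.inl h, D.adjoinProj_inl x h⟩
  have := Fintype.ofFinite G
  obtain ⟨H, hH, D, hD⟩ := key Finset.univ.toList
  exact ⟨H, hH, D, fun x => hD x (by simp)⟩

lemma ker_proj_le_center : D.proj.ker ≤ Subgroup.center H := by
  intro u hu
  rw [MonoidHom.mem_ker] at hu
  rw [Subgroup.mem_center_iff]
  intro v
  have : ⁅u, v⁆ = 1 := by rw [D.commutator_eq, hu, wedge_one_left, map_one]
  exact (commutatorElement_eq_one_iff_mul_comm.mp this).symm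

lemma incl_mem_commutator (hD : Function.Surjective D.proj) (e : ExteriorSquare G) :
    D.incl e ∈ commutator H := by
  have he : e ∈ Subgroup.closure {e : ExteriorSquare G | ∃ g h, wedge g h = e} := by
    rw [closure_wedge]; trivial
  induction he using Subgroup.closure_induction with
  | mem e he =>
    obtain ⟨g, h, rfl⟩ := he
    obtain ⟨u, rfl⟩ := hD g
    obtain ⟨v, rfl⟩ := hD h
    rw [← D.commutator_eq]
    exact Subgroup.commutator_mem_commutator (Subgroup.mem_top u) (Subgroup.mem_top v)
  | one => rw [map_one]; exact one_mem _
  | mul a b _ _ ha hb => rw [map_mul]; exact mul_mem ha hb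
  | inv a _ ha => rw [map_inv]; exact inv_mem ha

end CommutatorModel

/-- If the commutator subgroups of all central extensions of `G` have exponent dividing `m`, so
does the exterior square. -/
theorem pow_eq_one_of_central_extensions [Finite G] {m : ℕ}
    (hm : ∀ (K : Type u) [Group K] (q : K →* G), q.ker ≤ Subgroup.center K →
      ∀ z ∈ commutator K, z ^ m = 1) (e : ExteriorSquare G) : e ^ m = 1 := by
  obtain ⟨H, _, D, hD⟩ := CommutatorModel.exists_surjective (G := G)
  apply D.incl_injective
  rw [map_pow, map_one]
  exact hm H D.proj D.ker_proj_le_center _ (D.incl_mem_commutator hD e)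

end ExteriorSquare

/-! ### Central extensions from two-cocycles -/

/-- A two-cocycle on `G` with values in a trivial module. -/
structure TrivialTwoCocycle (G A : Type u) [Group G] [AddCommGroup A] where
  /-- The underlying function. -/
  toFun : G → G → A
  cocycle : ∀ g h k, toFun g h + toFun (g * h) k = toFun h k + toFun g (h * k)

namespace TrivialTwoCocycle

variable {G A : Type u} [Group G] [AddCommGroup A] (f : TrivialTwoCocycle G A)

lemma one_left (g : G) : f.toFun 1 g = f.toFun 1 1 := by
  have := f.cocycle 1 1 g
  simp only [one_mul] at this
  exact (add_right_cancel this).symm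

lemma one_right (g : G) : f.toFun g 1 = f.toFun 1 1 := by
  have := f.cocycle g 1 1
  simp only [mul_one] at this
  exact add_right_cancel this

/-- The central extension of `G` by `A` defined by a cocycle. -/
@[ext] structure Ext (f : TrivialTwoCocycle G A) : Type u where
  /-- The coordinate in `A`. -/
  fst : A
  /-- The coordinate in `G`. -/
  snd : G

instance : Mul f.Ext := ⟨fun x y => ⟨x.fst + y.fst + f.toFun x.snd y.snd, x.snd * y.snd⟩⟩
-- The cocycle is not assumed normalized, so the identity is offset by `f(1, 1)`.
instance : One f.Ext := ⟨⟨-f.toFun 1 1, 1⟩⟩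
instance : Inv f.Ext := ⟨fun x => ⟨-x.fst - f.toFun x.snd⁻¹ x.snd - f.toFun 1 1, x.snd⁻¹⟩⟩

lemma mul_def (x y : f.Ext) :
    x * y = ⟨x.fst + y.fst + f.toFun x.snd y.snd, x.snd * y.snd⟩ := rfl
lemma one_def : (1 : f.Ext) = ⟨-f.toFun 1 1, 1⟩ := rfl
lemma inv_def (x : f.Ext) :
    x⁻¹ = ⟨-x.fst - f.toFun x.snd⁻¹ x.snd - f.toFun 1 1, x.snd⁻¹⟩ := rfl

instance : Group f.Ext :=
  Group.ofLeftAxioms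
    (fun x y z => by
      simp only [mul_def, Ext.mk.injEq, mul_assoc, and_true]
      have := f.cocycle x.snd y.snd z.snd
      rw [show x.fst + y.fst + f.toFun x.snd y.snd + z.fst + f.toFun (x.snd * y.snd) z.snd =
        x.fst + y.fst + z.fst + (f.toFun x.snd y.snd + f.toFun (x.snd * y.snd) z.snd) by abel, this]
      abel)
    (fun x => by
      rw [one_def, mul_def]
      ext
      · simp [one_left]
      · simp)
    (fun x => by
      rw [inv_def, mul_def, one_def]
      ext
      · simp only; abel
      · simp)

/-- The projection onto `G`. -/
def proj : f.Ext →* G := MonoidHom.mk' Ext.snd fun _ _ => rfl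

lemma ker_proj_le_center : f.proj.ker ≤ Subgroup.center f.Ext := by
  intro x hx
  have hx : x.snd = 1 := hx
  rw [Subgroup.mem_center_iff]
  intro y
  rw [mul_def, mul_def, hx]
  ext
  · simp only [one_left, one_right]; abel
  · simp

/-- The inclusion of the kernel. -/
def incl : Multiplicative A →* f.Ext :=
  MonoidHom.mk' (fun a => ⟨a.toAdd - f.toFun 1 1, 1⟩) fun a b => by
    rw [mul_def]
    ext
    · simp only [toAdd_mul]; abel
    · simp

lemma incl_injective : Function.Injective f.incl := fun a b h => by
  have := congrArg Ext.fst h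
  exact Multiplicative.toAdd.injective (sub_left_injective this)

/-- The set-theoretic section. -/
def sec (g : G) : f.Ext := ⟨0, g⟩

lemma sec_mul_sec (g h : G) :
    f.sec g * f.sec h = f.incl (Multiplicative.ofAdd (f.toFun g h)) * f.sec (g * h) := by
  rw [mul_def, mul_def]
  ext
  · change 0 + 0 + f.toFun g h = f.toFun g h - f.toFun 1 1 + 0 + f.toFun 1 (g * h)
    rw [f.one_left (g * h)]; abel
  · exact (one_mul _).symm

/-- The map from the kernel to the abelianization of the extension. -/
def inclAb : A →+ Additive (Abelianization f.Ext) :=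
  MonoidHom.toAdditiveRight (Abelianization.of.comp f.incl)

lemma inclAb_toFun (g h : G) : f.inclAb (f.toFun g h) =
    Additive.ofMul (Abelianization.of (f.sec h)) -
      Additive.ofMul (Abelianization.of (f.sec (g * h))) +
      Additive.ofMul (Abelianization.of (f.sec g)) := by
  have h1 := congrArg (fun x => Additive.ofMul (Abelianization.of x)) (f.sec_mul_sec g h)
  simp only [map_mul, ofMul_mul] at h1
  have h2 : f.inclAb (f.toFun g h) =
    Additive.ofMul (Abelianization.of (f.incl (Multiplicative.ofAdd (f.toFun g h)))) := rfl
  rw [h2, ← sub_eq_iff_eq_add.mpr h1]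
  abel

/-- Elements of the kernel that die in the abelianization are killed by the exponent of the
commutator subgroup. -/
lemma nsmul_eq_zero {m : ℕ} (hm : ∀ z ∈ commutator f.Ext, z ^ m = 1) {a : A}
    (ha : f.inclAb a = 0) : m • a = 0 := by
  have h1 : Abelianization.of (f.incl (Multiplicative.ofAdd a)) = 1 := ha
  rw [← MonoidHom.mem_ker, Abelianization.ker_of] at h1
  have h2 := hm _ h1
  rw [← map_pow, ← map_one f.incl] at h2
  exact f.incl_injective h2

end TrivialTwoCocycle

/-! ### The Schur multiplier -/

namespace SchurMultiplier

open groupHomology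

variable (G : Type u) [Group G]

/-- The trivial representation on the integers. -/
noncomputable abbrev coeff : Rep (ULift.{u} ℤ) G := Rep.trivial (ULift.{u} ℤ) G (ULift.{u} ℤ)

/-- Two-chains modulo boundaries. -/
abbrev ChainQuotient : Type u := (G × G →₀ coeff G) ⧸ boundaries₂ (coeff G)

/-- The tautological cocycle with values in two-chains modulo boundaries. -/
noncomputable def tautCocycle : TrivialTwoCocycle G (ChainQuotient G) where
  toFun g h := Submodule.Quotient.mk (Finsupp.single (g, h) (ULift.up 1 : ULift.{u} ℤ))
  cocycle g h k := by
    rw [← Submodule.Quotient.mk_add, ← Submodule.Quotient.mk_add, eq_comm,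
      Submodule.Quotient.eq]
    refine ⟨Finsupp.single (g, h, k) (ULift.up 1 : ULift.{u} ℤ), ?_⟩
    refine (d₃₂_single (A := coeff G) (g, h, k) (ULift.up 1 : ULift.{u} ℤ)).trans ?_
    rw [Rep.trivial_ρ_apply]
    abel

/-- The map from one-chains to the abelianized extension. -/
noncomputable def chainSec : (G →₀ coeff G) →+ Additive (Abelianization (tautCocycle G).Ext) :=
  Finsupp.liftAddHom fun g =>
    (zmultiplesHom _ (Additive.ofMul (Abelianization.of ((tautCocycle G).sec g)))).comp
      (AddEquiv.ulift : ULift.{u} ℤ ≃+ ℤ).toAddMonoidHom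

lemma chainSec_single (g : G) (n : ULift.{u} ℤ) :
    chainSec G (Finsupp.single g n) =
      n.down • Additive.ofMul (Abelianization.of ((tautCocycle G).sec g)) :=
  (Finsupp.liftAddHom_apply_single _ _ _)

/-- In the abelianized extension `f(g, h)` becomes the image of the boundary `[h] - [gh] + [g]`.
Hence every 2-cycle dies there, that is, its class lies in the commutator subgroup of the extension.
-/
lemma inclAb_mk (x : G × G →₀ coeff G) :
    (tautCocycle G).inclAb (Submodule.Quotient.mk x) = chainSec G (d₂₁ (coeff G) x) := by
  have : (tautCocycle G).inclAb.comp (boundaries₂ (coeff G)).mkQ.toAddMonoidHom =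
      (chainSec G).comp (d₂₁ (coeff G)).hom.toAddMonoidHom := by
    refine Finsupp.addHom_ext fun gh n => ?_
    obtain ⟨g, h⟩ := gh
    have e1 : (Finsupp.single (g, h) n : G × G →₀ coeff G) =
        (n : ULift.{u} ℤ).down • Finsupp.single (g, h) (ULift.up 1 : ULift.{u} ℤ) := by
      rw [Finsupp.smul_single]
      congr 1
      exact ULift.ext _ _ (by simp)
    have e2 : (tautCocycle G).inclAb (Submodule.Quotient.mk (Finsupp.single (g, h) n)) =
        (n : ULift.{u} ℤ).down • (tautCocycle G).inclAb ((tautCocycle G).toFun g h) := by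
      rw [e1, ← map_zsmul]; rfl
    refine e2.trans ?_
    refine Eq.trans ?_ (congrArg (chainSec G) (d₂₁_single (A := coeff G) (g, h) n)).symm
    rw [map_add, map_sub, Rep.trivial_ρ_apply, chainSec_single, chainSec_single, chainSec_single,
      TrivialTwoCocycle.inclAb_toFun, smul_add, smul_sub]
  exact DFunLike.congr_fun this x

/-- If the commutator subgroups of all central extensions of `G` have exponent dividing `m`, then
the Schur multiplier has exponent dividing `m`. -/
theorem nsmul_eq_zero_of_central_extensions {m : ℕ}
    (hm : ∀ (K : Type u) [Group K] (q : K →* G), q.ker ≤ Subgroup.center K →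
      ∀ z ∈ commutator K, z ^ m = 1) (x : SchurMultiplier G) : m • x = 0 := by
  induction x using H2_induction_on with
  | h x =>
    rw [← map_nsmul, H2π_eq_zero_iff]
    have hx : d₂₁ (coeff G) x.1 = 0 := x.2
    have h1 : (tautCocycle G).inclAb (Submodule.Quotient.mk x.1) = 0 := by
      rw [inclAb_mk, hx, map_zero]
    have h2 := (tautCocycle G).nsmul_eq_zero
      (hm _ (tautCocycle G).proj (tautCocycle G).ker_proj_le_center) h1
    rwa [← Submodule.Quotient.mk_smul, Submodule.Quotient.mk_eq_zero] at h2

end SchurMultiplier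

theorem lemma1p1 {G : Type u} [Group G] [Finite G] (p n : ℕ) (hp : p.Prime) (hp_odd : Odd p)
    (hG : IsPGroup p G) (hexp : Monoid.exponent G = p ^ n)
    (h_powerful : IsPowerful p (powerSubgroup G p))
    (h_exp_pow : Monoid.exponent (powerSubgroup G p) = p ^ (n - 1))
    (h_lower : (⊤ : Subgroup G).lowerCentralSeries p ≤ powerSubgroup G p) :
    Monoid.exponent (ExteriorSquare G) ∣ Monoid.exponent G ∧
      AddMonoid.exponent (SchurMultiplier G) ∣ Monoid.exponent G := by
  have hpowerful : ⁅powerSubgroup G p, powerSubgroup G p⁆ ≤ (powerSubgroup G p).powClosure p := by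
    have h2 : p ≠ 2 := by rintro rfl; exact absurd hp_odd (by decide)
    rw [IsPowerful, if_neg h2] at h_powerful
    -- Powerfulness is stated inside the group `G ^ p`; it is transported to subgroups of `G` along
    -- the inclusion.
    have h := Subgroup.map_mono (f := (powerSubgroup G p).subtype) h_powerful
    rw [commutator_def, Subgroup.map_commutator, ← MonoidHom.range_eq_map,
      Subgroup.range_subtype] at h
    refine h.trans ?_
    rw [Subgroup.map_le_iff_le_comap]
    refine (Subgroup.closure_le _).mpr ?_
    rintro _ ⟨x, rfl⟩
    exact Subgroup.pow_mem_powClosure x.2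
  have hcentral : ∀ (K : Type u) [Group K] (q : K →* G), q.ker ≤ Subgroup.center K →
      ∀ z ∈ commutator K, z ^ Monoid.exponent G = 1 := by
    intro K _ q hq z hz
    rw [hexp]
    refine pow_eq_one_of_mem_commutator_of_central hp hp_odd hG
      (fun g => hexp ▸ Monoid.pow_exponent_eq_one g) hpowerful (fun g hg => ?_) h_lower q hq hz
    have := Monoid.pow_exponent_eq_one (⟨g, hg⟩ : powerSubgroup G p)
    rw [h_exp_pow] at this
    exact congrArg Subtype.val this
  exact ⟨Monoid.exponent_dvd_of_forall_pow_eq_one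
      (ExteriorSquare.pow_eq_one_of_central_extensions hcentral),
    AddMonoid.exponent_dvd_of_forall_nsmul_eq_zero
      (SchurMultiplier.nsmul_eq_zero_of_central_extensions G hcentral)⟩
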